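/- Consider the first-in-first-out $G/G/1$ queue: the interarrival times are i.i.d. copies of $U\ge 0$, the service times are i.i.d. copies of $S\ge 0$, and the two sequences are independent. Assume that $\mathbb{E}U^3<\infty$, $\mathbb{E}S^3<\infty$, $\mathbb{E}S>0$, and that $U$ is nonlattice (for no $d>0$ is $U$ concentrated on the integer multiples of $d$). Put $\lambda=1/\mathbb{E}U$, $\rho=\lambda\,\mathbb{E}S$, and assume $\rho<1$. Let a customer arrive to an empty system at time $0$, let $V(t)$ be the workload (remaining work) at time $t\ge 0$, and let $X$ have the limiting steady-state distribution of the scaled workload, that is, $(1-\rho)V(t)\to X$ in distribution as $t\to\infty$. Let $\bar I$ be the duration of the idle period that follows the busy period started by an arrival to an empty system. Let $Y$ be exponentially distributed with rate $2/(\lambda\,\mathbb{E}(S-\rho U)^2)$, where $S$ and $U$ are independent. Then $\mathbb{E}|X|<\infty$, $\mathbb{E}\bar I^2<\infty$, $\mathbb{E}\bar I>0$, and \[ \sup_{h\in \mathrm{Lip}(1)}\bigl|\mathbb{E}h(X)-\mathbb{E}h(Y)\bigr|\le (1-\rho)\left((2+\rho)\frac{\mathbb{E}U^2}{2\,\mathbb{E}U}+\rho\,\frac{\mathbb{E}\bar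 I^2}{2\,\mathbb{E}\bar I}+2\,\mathbb{E}S+4\,\frac{\mathbb{E}|S-\rho U|^3}{\mathbb{E}(S-\rho U)^2}\right), \] where $\mathrm{Lip}(1)$ is the set of functions $h:\mathbb{R}\to\mathbb{R}$ with Lipschitz constant at most $1$. -/

import Mathlib

open MeasureTheory ProbabilityTheory Filter Topology

noncomputable section

namespace GG1

variable {Ω : Type*}

/-- The interarrival times `U 0, U 1, …` and the service times `S 0, S 1, …` of a `G/G/1` queue:
two independent sequences of i.i.d. nonnegative random variables. Customer `0` arrives at time `0`,
`U n` is the time between the arrivals of the customers `n` and `n + 1`, and `S n` is the service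
time of customer `n`. -/
structure IsInput [MeasurableSpace Ω] (P : Measure Ω) (U S : ℕ → Ω → ℝ) : Prop where
  measurable_interarrival : ∀ n, Measurable (U n)
  measurable_service : ∀ n, Measurable (S n)
  nonneg_interarrival : ∀ n, ∀ᵐ ω ∂P, 0 ≤ U n ω
  nonneg_service : ∀ n, ∀ᵐ ω ∂P, 0 ≤ S n ω
  identDistrib_interarrival : ∀ n, IdentDistrib (U n) (U 0) P P
  identDistrib_service : ∀ n, IdentDistrib (S n) (S 0) P P
  indep : iIndepFun (fun i : ℕ ⊕ ℕ => Sum.elim U S i) P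

/-- A random variable is nonlattice if, for every `d > 0`, it is not concentrated on the integer
multiples of `d`. -/
def Nonlattice [MeasurableSpace Ω] (P : Measure Ω) (T : Ω → ℝ) : Prop :=
  ∀ d : ℝ, 0 < d → ¬ ∀ᵐ ω ∂P, ∃ k : ℤ, T ω = k * d

/-- The arrival rate `λ = 1 / 𝔼 U`. -/
def arrivalRate [MeasurableSpace Ω] (P : Measure Ω) (U : ℕ → Ω → ℝ) : ℝ :=
  1 / ∫ ω, U 0 ω ∂P

/-- The utilization `ρ = λ 𝔼 S`. -/
def utilization [MeasurableSpace Ω] (P : Measure Ω) (U S : ℕ → Ω → ℝ) : ℝ :=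
  arrivalRate P U * ∫ ω, S 0 ω ∂P

/-- The arrival time of customer `n`. -/
def arrivalTime (U : ℕ → Ω → ℝ) (n : ℕ) (ω : Ω) : ℝ :=
  ∑ k ∈ Finset.range n, U k ω

/-- The index of the last customer that arrived in `[0, t]`, for `t ≥ 0`. -/
def lastArrival (U : ℕ → Ω → ℝ) (t : ℝ) (ω : Ω) : ℕ :=
  sSup {n : ℕ | arrivalTime U n ω ≤ t}

/-- The workload found by customer `n`, the arrival of this customer excluded; customer `0` finds
an empty system. -/
def workloadBefore (U S : ℕ → Ω → ℝ) : ℕ → Ω → ℝ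
  | 0, _ => 0
  | n + 1, ω => max (workloadBefore U S n ω + S n ω - U n ω) 0

/-- The workload `V(t)` at time `t ≥ 0` when customer `0` arrives to an empty system at time `0`:
it jumps by `S n` at the arrival of customer `n` and decreases at unit rate while positive. -/
def workload (U S : ℕ → Ω → ℝ) (t : ℝ) (ω : Ω) : ℝ :=
  max (workloadBefore U S (lastArrival U t ω) ω + S (lastArrival U t ω) ω
    - (t - arrivalTime U (lastArrival U t ω) ω)) 0

/-- The residual time `R(t)`: the time from `t ≥ 0` until the next arrival. -/
def residual (U : ℕ → Ω → ℝ) (t : ℝ) (ω : Ω) : ℝ :=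
  arrivalTime U (lastArrival U t ω + 1) ω - t

/-- The duration of the busy period that starts when customer `0` arrives to an empty system at
time `0`: the first time at which the workload is zero. -/
def busyPeriod (U S : ℕ → Ω → ℝ) (ω : Ω) : ℝ :=
  sInf {t : ℝ | 0 ≤ t ∧ workload U S t ω = 0}

/-- The duration of the idle period that follows this busy period: the time from the end of the
busy period until the next arrival. -/
def idlePeriod (U S : ℕ → Ω → ℝ) (ω : Ω) : ℝ :=
  residual U (busyPeriod U S ω) ω

/-- The scaled workload `X(t) = (1 - ρ) V(t)`. -/
def scaledWorkload [MeasurableSpace Ω] (P : Measure Ω) (U S : ℕ → Ω → ℝ) (t : ℝ) (ω : Ω) : ℝ :=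
  (1 - utilization P U S) * workload U S t ω

/-- The steady state of the scaled workload: `X`, defined on a probability space of its own, has
the limiting distribution of `X(t)` as `t → ∞`. -/
def IsSteadyState [MeasurableSpace Ω] (P : Measure Ω) [IsProbabilityMeasure P] (U S : ℕ → Ω → ℝ)
    {Ω' : Type*} [MeasurableSpace Ω'] (P' : Measure Ω') [IsProbabilityMeasure P']
    (X : Ω' → ℝ) : Prop :=
  TendstoInDistribution (fun t : ℝ => scaledWorkload P U S t) atTop X (fun _ => P) P'

end GG1

end

/-
Stein's method for the exponential distribution. For a bounded Lipschitz function `h`, the solution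
`q` of the Stein equation `q' = r (q + h - 𝔼 h(Y))` with `q 0 = 0` turns `𝔼 h(X) - 𝔼 h(Y)` into the
stationary mean of the generator `κ F'' - (1 - ρ) F'` of a reflected Brownian motion, applied to a
test function `F` of the workload with `F' v = q ((1 - ρ) v)`. The time average of this generator
along the workload is a sum over the interarrival intervals. On each of them, Taylor's formula
compares the integral of the generator with the increment of `F`, and the increments telescope. With
`ρ` and `κ` chosen so that `S - ρ U` and `(S - ρ U) ^ 2 / 2 - κ U` have mean zero, the first and
second order terms vanish in expectation, since the workload found by a customer is independent of
the later interarrival and service times. What remains are third moments, and the squares of the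
idle times, since `F' 0 = 0` removes the first order effect of reflection. A renewal argument over
the busy cycles identifies the average of these squares through the moments of `Ī`.
-/

noncomputable section

namespace GG1

variable {Ω : Type*}

section Path

variable (U S : ℕ → Ω → ℝ)

/-- The sequence of all interarrival and service times from customer `k` on, as one random
element. -/
def inputPath (k : ℕ) (ω : Ω) : ℕ ⊕ ℕ → ℝ :=
  Sum.elim (fun i => U (k + i) ω) fun i => S (k + i) ω

/-- The σ-algebra generated by the interarrival and service times of the customers before `k`. -/
abbrev past (k : ℕ) : MeasurableSpace Ω :=
  ⨆ i ∈ {i : ℕ ⊕ ℕ | i.elim id id < k}, MeasurableSpace.comap (Sum.elim U S i) inferInstance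

lemma past_mono {j k : ℕ} (h : j ≤ k) : past U S j ≤ past U S k :=
  biSup_mono fun _ hi => lt_of_lt_of_le hi h

lemma measurable_past_input {k : ℕ} (i : ℕ ⊕ ℕ) (hi : i.elim id id < k) :
    Measurable[past U S k] (Sum.elim U S i) :=
  measurable_iff_comap_le.2 <| le_iSup₂_of_le (f := fun i _ =>
    MeasurableSpace.comap (Sum.elim U S i) inferInstance) i hi le_rfl

/-- The workload found by customer `k + 1` if the server could work ahead of the arrivals; it is
negative exactly when the server idles between the arrivals of the customers `k` and `k + 1`. -/
def freeWorkload (k : ℕ) (ω : Ω) : ℝ :=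
  workloadBefore U S k ω + S k ω - U k ω

/-- The idle time between the arrivals of the customers `k` and `k + 1`. -/
def idleTime (k : ℕ) (ω : Ω) : ℝ :=
  max (-freeWorkload U S k ω) 0

lemma workloadBefore_nonneg (k : ℕ) (ω : Ω) : 0 ≤ workloadBefore U S k ω := by
  cases k with
  | zero => exact le_rfl
  | succ k => exact le_max_right _ _

lemma idleTime_nonneg (k : ℕ) (ω : Ω) : 0 ≤ idleTime U S k ω := le_max_right _ _

lemma workloadBefore_succ (k : ℕ) (ω : Ω) :
    workloadBefore U S (k + 1) ω = freeWorkload U S k ω + idleTime U S k ω := by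
  rw [← sub_eq_iff_eq_add]
  exact max_zero_sub_eq_self (freeWorkload U S k ω)

lemma sq_workloadBefore_succ_le (k : ℕ) (ω : Ω) :
    workloadBefore U S (k + 1) ω ^ 2 ≤ workloadBefore U S k ω ^ 2
      + 2 * (workloadBefore U S k ω * (S k ω - U k ω)) + (S k ω - U k ω) ^ 2 := by
  have hsq := pow_le_pow_left₀ (workloadBefore_nonneg U S (k + 1) ω)
    (max_le (le_abs_self (freeWorkload U S k ω)) (abs_nonneg _)) 2
  rw [sq_abs, freeWorkload] at hsq
  exact hsq.trans_eq (by ring)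

variable {U S}

lemma workloadBefore_succ_of_nonneg {k : ℕ} {ω : Ω} (h : 0 ≤ freeWorkload U S k ω) :
    workloadBefore U S (k + 1) ω = freeWorkload U S k ω := max_eq_left h

lemma workloadBefore_succ_of_neg {k : ℕ} {ω : Ω} (h : freeWorkload U S k ω < 0) :
    workloadBefore U S (k + 1) ω = 0 := max_eq_right h.le

lemma idleTime_of_nonneg {k : ℕ} {ω : Ω} (h : 0 ≤ freeWorkload U S k ω) :
    idleTime U S k ω = 0 := max_eq_right (neg_nonpos.2 h)

lemma idleTime_of_neg {k : ℕ} {ω : Ω} (h : freeWorkload U S k ω < 0) :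
    idleTime U S k ω = -freeWorkload U S k ω := max_eq_left (neg_nonneg.2 h.le)

lemma measurable_past_workloadBefore (k : ℕ) :
    Measurable[past U S k] (workloadBefore U S k) := by
  induction k with
  | zero => exact measurable_const
  | succ k ih =>
    exact (((ih.mono (past_mono U S k.le_succ) le_rfl).add
      (measurable_past_input U S (.inr k) k.lt_succ_self)).sub
      (measurable_past_input U S (.inl k) k.lt_succ_self)).max measurable_const

lemma measurable_past_freeWorkload (k : ℕ) :
    Measurable[past U S (k + 1)] (freeWorkload U S k) :=
  (((measurable_past_workloadBefore k).mono (past_mono U S k.le_succ) le_rfl).add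
    (measurable_past_input U S (.inr k) k.lt_succ_self)).sub
    (measurable_past_input U S (.inl k) k.lt_succ_self)

lemma past_le [MeasurableSpace Ω] (hU : ∀ n, Measurable (U n)) (hS : ∀ n, Measurable (S n))
    (k : ℕ) : past U S k ≤ ‹MeasurableSpace Ω› :=
  iSup₂_le fun i _ => match i with
    | .inl n => (hU n).comap_le
    | .inr n => (hS n).comap_le

end Path

namespace IsInput

variable [MeasurableSpace Ω] {P : Measure Ω} {U S : ℕ → Ω → ℝ}

section Measurability

lemma measurable_input (h : IsInput P U S) : ∀ i : ℕ ⊕ ℕ, Measurable (Sum.elim U S i)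
  | .inl k => h.measurable_interarrival k
  | .inr k => h.measurable_service k

lemma past_le (h : IsInput P U S) (k : ℕ) : past U S k ≤ ‹MeasurableSpace Ω› :=
  GG1.past_le h.measurable_interarrival h.measurable_service k

lemma measurable_inputPath (h : IsInput P U S) (k : ℕ) : Measurable (inputPath U S k) :=
  measurable_pi_iff.2 <| by
    rintro (i | i)
    exacts [h.measurable_interarrival _, h.measurable_service _]

lemma measurable_workloadBefore (h : IsInput P U S) (k : ℕ) : Measurable (workloadBefore U S k) :=
  (measurable_past_workloadBefore k).mono (h.past_le k) le_rfl

lemma measurable_freeWorkload (h : IsInput P U S) (k : ℕ) : Measurable (freeWorkload U S k) :=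
  (measurable_past_freeWorkload k).mono (h.past_le _) le_rfl

lemma measurable_idleTime (h : IsInput P U S) (k : ℕ) : Measurable (idleTime U S k) :=
  (h.measurable_freeWorkload k).neg.max measurable_const

lemma ae_nonneg (h : IsInput P U S) : ∀ᵐ ω ∂P, (∀ n, 0 ≤ U n ω) ∧ ∀ n, 0 ≤ S n ω :=
  (ae_all_iff.2 h.nonneg_interarrival).and (ae_all_iff.2 h.nonneg_service)

end Measurability

section Independence

lemma indepFun_past_inputPath (h : IsInput P U S) {β : Type*} [MeasurableSpace β] {k : ℕ}
    {Z : Ω → β} (hZ : Measurable[past U S k] Z) : IndepFun Z (inputPath U S k) P := by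
  have hdisj : Disjoint {i : ℕ ⊕ ℕ | i.elim id id < k} {i | k ≤ i.elim id id} := by
    simp [Set.disjoint_left]
  have hfuture : (MeasurableSpace.pi.comap (inputPath U S k)) ≤
      ⨆ i ∈ {i : ℕ ⊕ ℕ | k ≤ i.elim id id},
        MeasurableSpace.comap (Sum.elim U S i) inferInstance := by
    simp only [MeasurableSpace.pi, MeasurableSpace.comap_iSup, MeasurableSpace.comap_comp]
    refine iSup_le fun i => ?_
    rcases i with i | i
    · exact le_iSup₂_of_le (f := fun i _ => MeasurableSpace.comap (Sum.elim U S i) inferInstance)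
        (.inl (k + i)) (Nat.le_add_right k i) le_rfl
    · exact le_iSup₂_of_le (f := fun i _ => MeasurableSpace.comap (Sum.elim U S i) inferInstance)
        (.inr (k + i)) (Nat.le_add_right k i) le_rfl
  rw [IndepFun_iff_Indep]
  exact indep_of_indep_of_le_left (indep_of_indep_of_le_right
    (indep_iSup_of_disjoint (fun i => (h.measurable_input i).comap_le) h.indep hdisj) hfuture)
    hZ.comap_le

lemma identDistrib_inputPath (h : IsInput P U S) (k : ℕ) :
    IdentDistrib (inputPath U S k) (inputPath U S 0) P P where
  aemeasurable_fst := (h.measurable_inputPath k).aemeasurable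
  aemeasurable_snd := (h.measurable_inputPath 0).aemeasurable
  map_eq := by
    have hmap : ∀ j, P.map (inputPath U S j)
        = Measure.infinitePi fun i => P.map (Sum.elim U S (i.map (j + ·) (j + ·))) := by
      intro j
      have hinj : Function.Injective (Sum.map (j + ·) (j + ·) : ℕ ⊕ ℕ → ℕ ⊕ ℕ) :=
        (add_right_injective j).sumMap (add_right_injective j)
      rw [← (h.indep.precomp hinj).map_fun_eq_infinitePi_map fun _ => h.measurable_input _]
      congr 1 with ω (i | i) <;> rfl
    rw [hmap k, hmap 0]
    congr 1 with i : 1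
    rcases i with i | i
    · exact ((h.identDistrib_interarrival _).trans (h.identDistrib_interarrival _).symm).map_eq
    · exact ((h.identDistrib_service _).trans (h.identDistrib_service _).symm).map_eq

lemma identDistrib_pair (h : IsInput P U S) (k : ℕ) :
    IdentDistrib (fun ω => (U k ω, S k ω)) (fun ω => (U 0 ω, S 0 ω)) P P :=
  (h.identDistrib_inputPath k).comp (u := fun x => (x (.inl 0), x (.inr 0))) (by fun_prop)

lemma integral_past_mul_inputPath (h : IsInput P U S) {k : ℕ} {Z : Ω → ℝ}
    (hZ : Measurable[past U S k] Z) {f : (ℕ ⊕ ℕ → ℝ) → ℝ} (hf : Measurable f) :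
    ∫ ω, Z ω * f (inputPath U S k ω) ∂P
      = (∫ ω, Z ω ∂P) * ∫ ω, f (inputPath U S 0 ω) ∂P := by
  have heq : ∫ ω, f (inputPath U S k ω) ∂P = ∫ ω, f (inputPath U S 0 ω) ∂P :=
    ((h.identDistrib_inputPath k).comp hf).integral_eq
  rw [← heq]
  exact ((h.indepFun_past_inputPath hZ).comp measurable_id hf).integral_fun_mul_eq_mul_integral
    (hZ.mono (h.past_le k) le_rfl).aestronglyMeasurable
    (hf.comp (h.measurable_inputPath k)).aestronglyMeasurable

lemma integrable_past_mul_inputPath (h : IsInput P U S) {k : ℕ} {Z : Ω → ℝ}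
    (hZ : Measurable[past U S k] Z) (hZi : Integrable Z P) {f : (ℕ ⊕ ℕ → ℝ) → ℝ}
    (hf : Measurable f) (hfi : Integrable (fun ω => f (inputPath U S 0 ω)) P) :
    Integrable (fun ω => Z ω * f (inputPath U S k ω)) P :=
  ((h.indepFun_past_inputPath hZ).comp measurable_id hf).integrable_mul hZi
    (((h.identDistrib_inputPath k).comp hf).integrable_iff.2 hfi)

lemma integral_past_mul (h : IsInput P U S) {k : ℕ} {Z : Ω → ℝ}
    (hZ : Measurable[past U S k] Z) {φ : ℝ × ℝ → ℝ} (hφ : Measurable φ) :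
    ∫ ω, Z ω * φ (U k ω, S k ω) ∂P = (∫ ω, Z ω ∂P) * ∫ ω, φ (U 0 ω, S 0 ω) ∂P :=
  h.integral_past_mul_inputPath hZ (f := fun x => φ (x (.inl 0), x (.inr 0))) (by fun_prop)

lemma integrable_past_mul (h : IsInput P U S) {k : ℕ} {Z : Ω → ℝ}
    (hZ : Measurable[past U S k] Z) (hZi : Integrable Z P) {φ : ℝ × ℝ → ℝ} (hφ : Measurable φ)
    (hφi : Integrable (fun ω => φ (U 0 ω, S 0 ω)) P) :
    Integrable (fun ω => Z ω * φ (U k ω, S k ω)) P :=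
  h.integrable_past_mul_inputPath hZ hZi (f := fun x => φ (x (.inl 0), x (.inr 0)))
    (by fun_prop) hφi

end Independence

section Moments

lemma memLp_interarrival (h : IsInput P U S) {p : ENNReal} (hU : MemLp (U 0) p P) (k : ℕ) :
    MemLp (U k) p P :=
  (h.identDistrib_interarrival k).memLp_iff.2 hU

lemma memLp_service (h : IsInput P U S) {p : ENNReal} (hS : MemLp (S 0) p P) (k : ℕ) :
    MemLp (S k) p P :=
  (h.identDistrib_service k).memLp_iff.2 hS

lemma memLp_workloadBefore (h : IsInput P U S) {p : ENNReal} (hU : MemLp (U 0) p P)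
    (hS : MemLp (S 0) p P) (k : ℕ) : MemLp (workloadBefore U S k) p P := by
  induction k with
  | zero => exact MemLp.zero
  | succ k ih =>
    exact ((ih.add (h.memLp_service hS k)).sub (h.memLp_interarrival hU k)).pos_part

lemma memLp_freeWorkload (h : IsInput P U S) {p : ENNReal} (hU : MemLp (U 0) p P)
    (hS : MemLp (S 0) p P) (k : ℕ) : MemLp (freeWorkload U S k) p P :=
  ((h.memLp_workloadBefore hU hS k).add (h.memLp_service hS k)).sub (h.memLp_interarrival hU k)

lemma memLp_idleTime (h : IsInput P U S) {p : ENNReal} (hU : MemLp (U 0) p P)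
    (hS : MemLp (S 0) p P) (k : ℕ) : MemLp (idleTime U S k) p P :=
  (h.memLp_freeWorkload hU hS k).neg_part

variable [IsProbabilityMeasure P]

lemma integral_sq_workloadBefore_le (h : IsInput P U S) (hU : MemLp (U 0) 2 P)
    (hS : MemLp (S 0) 2 P) (hdrift : ∫ ω, S 0 ω ∂P ≤ ∫ ω, U 0 ω ∂P) (n : ℕ) :
    ∫ ω, workloadBefore U S n ω ^ 2 ∂P ≤ n * ∫ ω, (S 0 ω - U 0 ω) ^ 2 ∂P := by
  induction n with
  | zero => simp [workloadBefore]
  | succ n ih =>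
    have hUi := hU.integrable one_le_two
    have hSi := hS.integrable one_le_two
    have hW := h.memLp_workloadBefore hU hS n
    have hφ : Measurable fun p : ℝ × ℝ => p.2 - p.1 := by fun_prop
    have hcross : ∫ ω, workloadBefore U S n ω * (S n ω - U n ω) ∂P ≤ 0 := by
      rw [h.integral_past_mul (measurable_past_workloadBefore n) hφ, integral_sub hSi hUi]
      exact mul_nonpos_of_nonneg_of_nonpos (integral_nonneg (workloadBefore_nonneg U S n))
        (sub_nonpos.2 hdrift)
    have hcross_int : Integrable (fun ω => 2 * (workloadBefore U S n ω * (S n ω - U n ω))) P :=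
      (h.integrable_past_mul (measurable_past_workloadBefore n) (hW.integrable one_le_two) hφ
        (hSi.sub hUi)).const_mul 2
    have hstep_int : Integrable (fun ω => (S n ω - U n ω) ^ 2) P :=
      ((h.memLp_service hS n).sub (h.memLp_interarrival hU n)).integrable_sq
    have hstep : ∫ ω, (S n ω - U n ω) ^ 2 ∂P = ∫ ω, (S 0 ω - U 0 ω) ^ 2 ∂P :=
      ((h.identDistrib_pair n).comp (hφ.pow_const 2)).integral_eq
    calc ∫ ω, workloadBefore U S (n + 1) ω ^ 2 ∂P
        ≤ ∫ ω, (workloadBefore U S n ω ^ 2 + 2 * (workloadBefore U S n ω * (S n ω - U n ω))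
          + (S n ω - U n ω) ^ 2) ∂P :=
          integral_mono (h.memLp_workloadBefore hU hS (n + 1)).integrable_sq
            ((hW.integrable_sq.add hcross_int).add hstep_int) (sq_workloadBefore_succ_le U S n)
      _ = ∫ ω, workloadBefore U S n ω ^ 2 ∂P
          + 2 * ∫ ω, workloadBefore U S n ω * (S n ω - U n ω) ∂P
          + ∫ ω, (S 0 ω - U 0 ω) ^ 2 ∂P := by
          rw [integral_add (hW.integrable_sq.fun_add hcross_int) hstep_int,
            integral_add hW.integrable_sq hcross_int, integral_const_mul, hstep]
      _ ≤ (n + 1 : ℕ) * ∫ ω, (S 0 ω - U 0 ω) ^ 2 ∂P := by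
          push_cast
          linarith

lemma tendsto_integral_workloadBefore_div (h : IsInput P U S) (hU : MemLp (U 0) 2 P)
    (hS : MemLp (S 0) 2 P) (hdrift : ∫ ω, S 0 ω ∂P ≤ ∫ ω, U 0 ω ∂P) :
    Tendsto (fun n : ℕ => (n : ℝ)⁻¹ * ∫ ω, workloadBefore U S n ω ∂P) atTop (𝓝 0) := by
  set C := ∫ ω, (S 0 ω - U 0 ω) ^ 2 ∂P
  have hlim : Tendsto (fun n : ℕ => √((n : ℝ)⁻¹ * C)) atTop (𝓝 0) := by
    simpa using ((tendsto_inv_atTop_nhds_zero_nat (𝕜 := ℝ)).mul_const C).sqrt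
  have hmean (n : ℕ) : 0 ≤ ∫ ω, workloadBefore U S n ω ∂P :=
    integral_nonneg (workloadBefore_nonneg U S n)
  refine squeeze_zero' (.of_forall fun n => mul_nonneg (by positivity) (hmean n)) ?_ hlim
  filter_upwards [eventually_gt_atTop 0] with n hn
  have hjensen : (∫ ω, workloadBefore U S n ω ∂P) ^ 2 ≤ ∫ ω, workloadBefore U S n ω ^ 2 ∂P := by
    have := variance_nonneg (workloadBefore U S n) P
    rw [variance_eq_sub (h.memLp_workloadBefore hU hS n)] at this
    exact sub_nonneg.1 this
  apply Real.le_sqrt_of_sq_le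
  calc ((n : ℝ)⁻¹ * ∫ ω, workloadBefore U S n ω ∂P) ^ 2
      = (n : ℝ)⁻¹ ^ 2 * (∫ ω, workloadBefore U S n ω ∂P) ^ 2 := mul_pow _ _ _
    _ ≤ (n : ℝ)⁻¹ ^ 2 * (n * C) := by
        gcongr
        exact hjensen.trans (h.integral_sq_workloadBefore_le hU hS hdrift n)
    _ = (n : ℝ)⁻¹ * C := by field_simp

lemma integral_workloadBefore_succ (h : IsInput P U S) (hU : Integrable (U 0) P)
    (hS : Integrable (S 0) P) (n : ℕ) :
    ∫ ω, workloadBefore U S (n + 1) ω ∂P = ∫ ω, workloadBefore U S n ω ∂P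
      + ∫ ω, S 0 ω ∂P - ∫ ω, U 0 ω ∂P + ∫ ω, idleTime U S n ω ∂P := by
  rw [← memLp_one_iff_integrable] at hU hS
  have hW := (h.memLp_workloadBefore hU hS n).integrable le_rfl
  have hSn := (h.memLp_service hS n).integrable le_rfl
  have hUn := (h.memLp_interarrival hU n).integrable le_rfl
  simp_rw [workloadBefore_succ]
  rw [integral_add ((h.memLp_freeWorkload hU hS n).integrable le_rfl)
    ((h.memLp_idleTime hU hS n).integrable le_rfl)]
  simp_rw [freeWorkload]
  rw [integral_sub (hW.fun_add hSn) hUn, integral_add hW hSn,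
    (h.identDistrib_interarrival n).integral_eq, (h.identDistrib_service n).integral_eq]

lemma sum_integral_idleTime (h : IsInput P U S) (hU : Integrable (U 0) P)
    (hS : Integrable (S 0) P) (n : ℕ) :
    ∑ k ∈ Finset.range n, ∫ ω, idleTime U S k ω ∂P
      = ∫ ω, workloadBefore U S n ω ∂P + n * (∫ ω, U 0 ω ∂P - ∫ ω, S 0 ω ∂P) := by
  induction n with
  | zero => simp [workloadBefore]
  | succ n ih =>
    rw [Finset.sum_range_succ, ih, h.integral_workloadBefore_succ hU hS]
    push_cast
    ring

lemma tendsto_sum_integral_idleTime (h : IsInput P U S) (hU : MemLp (U 0) 2 P)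
    (hS : MemLp (S 0) 2 P) (hdrift : ∫ ω, S 0 ω ∂P ≤ ∫ ω, U 0 ω ∂P) :
    Tendsto (fun n : ℕ => (n : ℝ)⁻¹ * ∑ k ∈ Finset.range n, ∫ ω, idleTime U S k ω ∂P) atTop
      (𝓝 (∫ ω, U 0 ω ∂P - ∫ ω, S 0 ω ∂P)) := by
  have hlim := (h.tendsto_integral_workloadBefore_div hU hS hdrift).add_const
    (∫ ω, U 0 ω ∂P - ∫ ω, S 0 ω ∂P)
  rw [zero_add] at hlim
  refine hlim.congr' ?_
  filter_upwards [eventually_gt_atTop 0] with n hn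
  rw [h.sum_integral_idleTime (hU.integrable one_le_two) (hS.integrable one_le_two)]
  field_simp

end Moments

end IsInput

section BusyPeriod

variable {U S : ℕ → Ω → ℝ} {ω : Ω}

lemma arrivalTime_succ (U : ℕ → Ω → ℝ) (n : ℕ) (ω : Ω) :
    arrivalTime U (n + 1) ω = arrivalTime U n ω + U n ω :=
  Finset.sum_range_succ _ n

lemma arrivalTime_monotone (hU : ∀ n, 0 ≤ U n ω) : Monotone fun n => arrivalTime U n ω :=
  monotone_nat_of_le_succ fun n => by
    rw [arrivalTime_succ]
    exact le_add_of_nonneg_right (hU n)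

lemma lastArrival_eq (hU : ∀ n, 0 ≤ U n ω) {k : ℕ} {t : ℝ} (hk : arrivalTime U k ω ≤ t)
    (hk' : t < arrivalTime U (k + 1) ω) : lastArrival U t ω = k := by
  have hset : {n : ℕ | arrivalTime U n ω ≤ t} = Set.Iic k := by
    ext n
    refine ⟨fun hn => ?_, fun hn => (arrivalTime_monotone hU hn).trans hk⟩
    by_contra! hkn
    exact (hk'.trans_le (arrivalTime_monotone hU (Nat.succ_le_of_lt (not_le.1 hkn)))).not_ge hn
  rw [lastArrival, hset, csSup_Iic]

lemma workload_eq (hU : ∀ n, 0 ≤ U n ω) {k : ℕ} {t : ℝ} (hk : arrivalTime U k ω ≤ t)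
    (hk' : t < arrivalTime U (k + 1) ω) :
    workload U S t ω = max (workloadBefore U S k ω + S k ω - (t - arrivalTime U k ω)) 0 := by
  rw [workload, lastArrival_eq hU hk hk']

lemma exists_arrivalTime_le_lt {n : ℕ} {t : ℝ} (h0 : 0 ≤ t) (ht : t < arrivalTime U n ω) :
    ∃ j < n, arrivalTime U j ω ≤ t ∧ t < arrivalTime U (j + 1) ω := by
  induction n with
  | zero => exact absurd ht (by simpa [arrivalTime] using h0)
  | succ n ih =>
    rcases lt_or_ge t (arrivalTime U n ω) with h | h
    · obtain ⟨j, hj, hjt⟩ := ih h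
      exact ⟨j, hj.trans n.lt_succ_self, hjt⟩
    · exact ⟨n, n.lt_succ_self, h, ht⟩

/-- The event that the server does not idle before the arrival of customer `k`. -/
def noIdle (U S : ℕ → Ω → ℝ) (k : ℕ) : Set Ω :=
  {ω | ∀ j < k, 0 ≤ freeWorkload U S j ω}

/-- The event that the first idle period precedes the arrival of customer `k + 1`: the first busy
period consists of the services of the customers `0, …, k`. -/
def firstIdle (U S : ℕ → Ω → ℝ) (k : ℕ) : Set Ω :=
  noIdle U S k ∩ {ω | freeWorkload U S k ω < 0}

lemma noIdle_zero (U S : ℕ → Ω → ℝ) : noIdle U S 0 = Set.univ := by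
  simp [noIdle]

lemma noIdle_succ (U S : ℕ → Ω → ℝ) (k : ℕ) :
    noIdle U S (k + 1) = noIdle U S k ∩ {ω | 0 ≤ freeWorkload U S k ω} := by
  ext ω
  exact Nat.forall_lt_succ_right

lemma pairwise_disjoint_firstIdle (U S : ℕ → Ω → ℝ) :
    Pairwise (Function.onFun Disjoint (firstIdle U S)) :=
  (pairwise_disjoint_on _).2 fun _ _ hjk =>
    Set.disjoint_left.2 fun _ hj hk => (hk.1 _ hjk).not_gt hj.2

lemma exists_mem_firstIdle {k : ℕ} (hω : ω ∉ noIdle U S k) : ∃ K, ω ∈ firstIdle U S K := by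
  classical
  have hex : ∃ j, freeWorkload U S j ω < 0 := by
    contrapose! hω
    exact fun j _ => hω j
  exact ⟨Nat.find hex, fun j hj => not_lt.1 (Nat.find_min hex hj), Nat.find_spec hex⟩

lemma busyPeriod_of_mem_firstIdle (hU : ∀ n, 0 ≤ U n ω) (hS : ∀ n, 0 ≤ S n ω) {K : ℕ}
    (hK : ω ∈ firstIdle U S K) :
    busyPeriod U S ω = arrivalTime U K ω + (workloadBefore U S K ω + S K ω) := by
  have hW := workloadBefore_nonneg U S K ω
  have hfree : workloadBefore U S K ω + S K ω - U K ω < 0 := hK.2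
  have hT0 : 0 ≤ arrivalTime U K ω := Finset.sum_nonneg fun n _ => hU n
  set t₀ := arrivalTime U K ω + (workloadBefore U S K ω + S K ω) with ht₀
  have ht₀_lt : t₀ < arrivalTime U (K + 1) ω := by rw [arrivalTime_succ]; linarith
  refine IsLeast.csInf_eq ⟨⟨by linarith [hS K], ?_⟩, ?_⟩
  · rw [workload_eq hU (by linarith [hS K]) ht₀_lt, ht₀, add_sub_cancel_left, sub_self, max_self]
  · rintro t ⟨ht, hzero⟩
    by_contra! hlt
    obtain ⟨j, hj, hjt, htj⟩ := exists_arrivalTime_le_lt (U := U) ht (hlt.trans ht₀_lt)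
    rw [workload_eq hU hjt htj] at hzero
    have hle := max_eq_right_iff.1 hzero
    rcases Nat.lt_succ_iff_lt_or_eq.1 hj with hjK | rfl
    · have hbusy : 0 ≤ workloadBefore U S j ω + S j ω - U j ω := hK.1 j hjK
      rw [arrivalTime_succ] at htj
      linarith
    · linarith

lemma idlePeriod_of_mem_firstIdle (hU : ∀ n, 0 ≤ U n ω) (hS : ∀ n, 0 ≤ S n ω) {K : ℕ}
    (hK : ω ∈ firstIdle U S K) : idlePeriod U S ω = idleTime U S K ω := by
  have hW := workloadBefore_nonneg U S K ω
  have hfree : workloadBefore U S K ω + S K ω - U K ω < 0 := hK.2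
  rw [idlePeriod, busyPeriod_of_mem_firstIdle hU hS hK, residual,
    lastArrival_eq hU (by linarith [hS K]) (by rw [arrivalTime_succ]; linarith),
    idleTime_of_neg hK.2, freeWorkload, arrivalTime_succ]
  ring

lemma freeWorkload_add_sq_nonneg {k : ℕ} (hS : 0 ≤ S k ω) {c : ℝ} (hc : 0 < c) :
    0 ≤ freeWorkload U S k ω + c + U k ω ^ 2 / (4 * c) := by
  have hW := workloadBefore_nonneg U S k ω
  calc 0 ≤ workloadBefore U S k ω + S k ω + (U k ω - 2 * c) ^ 2 / (4 * c) := by positivity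
    _ = freeWorkload U S k ω + c + U k ω ^ 2 / (4 * c) := by
        rw [freeWorkload]
        field_simp
        ring

lemma measurableSet_past_noIdle (U S : ℕ → Ω → ℝ) (k : ℕ) :
    MeasurableSet[past U S k] (noIdle U S k) := by
  induction k with
  | zero => rw [noIdle_zero]; exact MeasurableSet.univ
  | succ k ih =>
    rw [noIdle_succ]
    exact (past_mono U S k.le_succ _ ih).inter (measurable_past_freeWorkload k measurableSet_Ici)

end BusyPeriod

namespace IsInput

variable [MeasurableSpace Ω] {P : Measure Ω} {U S : ℕ → Ω → ℝ}

lemma setIntegral_past_inputPath (h : IsInput P U S) {k : ℕ} {A : Set Ω}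
    (hA : MeasurableSet[past U S k] A) {f : (ℕ ⊕ ℕ → ℝ) → ℝ} (hf : Measurable f) :
    ∫ ω in A, f (inputPath U S k ω) ∂P = P.real A * ∫ ω, f (inputPath U S 0 ω) ∂P := by
  have hA' := h.past_le k A hA
  rw [← integral_indicator_one hA', ← integral_indicator hA',
    ← h.integral_past_mul_inputPath (Z := A.indicator 1) (measurable_const.indicator hA) hf]
  exact integral_congr_ae <| .of_forall fun ω => by by_cases hω : ω ∈ A <;> simp [hω]

lemma setIntegral_past (h : IsInput P U S) {k : ℕ} {A : Set Ω}
    (hA : MeasurableSet[past U S k] A) {φ : ℝ × ℝ → ℝ} (hφ : Measurable φ) :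
    ∫ ω in A, φ (U k ω, S k ω) ∂P = P.real A * ∫ ω, φ (U 0 ω, S 0 ω) ∂P :=
  h.setIntegral_past_inputPath hA (f := fun x => φ (x (.inl 0), x (.inr 0))) (by fun_prop)

lemma measurableSet_noIdle (h : IsInput P U S) (k : ℕ) : MeasurableSet (noIdle U S k) :=
  h.past_le k _ (measurableSet_past_noIdle U S k)

lemma measurableSet_firstIdle (h : IsInput P U S) (k : ℕ) : MeasurableSet (firstIdle U S k) :=
  (h.measurableSet_noIdle k).inter (h.measurable_freeWorkload k measurableSet_Iio)

section Summability

variable [IsProbabilityMeasure P]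

lemma integral_drift_add_sq (hU : MemLp (U 0) 2 P) (hS : Integrable (S 0) P) (a : ℝ) :
    ∫ ω, (S 0 ω - U 0 ω + U 0 ω ^ 2 / a) ∂P
      = ∫ ω, S 0 ω ∂P - ∫ ω, U 0 ω ∂P + (∫ ω, U 0 ω ^ 2 ∂P) / a := by
  have hU1 := hU.integrable one_le_two
  have hdrift : Integrable (fun ω => S 0 ω - U 0 ω) P := hS.sub hU1
  rw [integral_add hdrift (hU.integrable_sq.div_const a), integral_sub hS hU1, integral_div]

-- A Lyapunov step: while the server does not idle, `W + c` loses `𝔼U - 𝔼S` per customer on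
-- average. The error term pays for the paths that start to idle at step `k`, where
-- `freeWorkload + c` is no longer counted but may be negative.
lemma setIntegral_noIdle_succ_le (h : IsInput P U S) (hU : MemLp (U 0) 2 P)
    (hS : Integrable (S 0) P) {c : ℝ} (hc : 0 < c) (k : ℕ) :
    ∫ ω in noIdle U S (k + 1), (workloadBefore U S (k + 1) ω + c) ∂P
      ≤ ∫ ω in noIdle U S k, (workloadBefore U S k ω + c) ∂P
        + P.real (noIdle U S k) *
          (∫ ω, S 0 ω ∂P - ∫ ω, U 0 ω ∂P + (∫ ω, U 0 ω ^ 2 ∂P) / (4 * c)) := by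
  have hU1 := memLp_one_iff_integrable.2 (hU.integrable one_le_two)
  have hS1 := memLp_one_iff_integrable.2 hS
  have hW (j : ℕ) : Integrable (fun ω => workloadBefore U S j ω + c) P :=
    ((h.memLp_workloadBefore hU1 hS1 j).integrable le_rfl).add (integrable_const c)
  have hsq : Integrable (fun ω => U k ω ^ 2 / (4 * c)) P :=
    (h.memLp_interarrival hU k).integrable_sq.div_const _
  have hinc : Integrable (fun ω => S k ω - U k ω + U k ω ^ 2 / (4 * c)) P :=
    (((h.memLp_service hS1 k).integrable le_rfl).sub
      ((h.memLp_interarrival hU1 k).integrable le_rfl)).add hsq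
  have hL : Integrable (fun ω => freeWorkload U S k ω + c + U k ω ^ 2 / (4 * c)) P :=
    (((h.memLp_freeWorkload hU1 hS1 k).integrable le_rfl).add (integrable_const c)).add hsq
  have hsubset : noIdle U S (k + 1) ⊆ noIdle U S k :=
    noIdle_succ U S k ▸ Set.inter_subset_left
  calc ∫ ω in noIdle U S (k + 1), (workloadBefore U S (k + 1) ω + c) ∂P
      ≤ ∫ ω in noIdle U S (k + 1), (freeWorkload U S k ω + c + U k ω ^ 2 / (4 * c)) ∂P := by
        refine setIntegral_mono_on (hW _).integrableOn hL.integrableOn (h.measurableSet_noIdle _)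
          fun ω hω => ?_
        rw [workloadBefore_succ_of_nonneg (hω k k.lt_succ_self)]
        exact le_add_of_nonneg_right (by positivity)
    _ ≤ ∫ ω in noIdle U S k, (freeWorkload U S k ω + c + U k ω ^ 2 / (4 * c)) ∂P :=
        setIntegral_mono_set hL.integrableOn (ae_restrict_of_ae <| h.ae_nonneg.mono fun ω hω =>
          freeWorkload_add_sq_nonneg (hω.2 k) hc) hsubset.eventuallyLE
    _ = ∫ ω in noIdle U S k, (workloadBefore U S k ω + c) ∂P
        + ∫ ω in noIdle U S k, (S k ω - U k ω + U k ω ^ 2 / (4 * c)) ∂P := by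
        rw [← integral_add (hW k).integrableOn hinc.integrableOn]
        congr 1 with ω
        rw [freeWorkload]
        ring
    _ = _ := by
        rw [h.setIntegral_past (φ := fun p => p.2 - p.1 + p.1 ^ 2 / (4 * c))
          (measurableSet_past_noIdle U S k) (by fun_prop), integral_drift_add_sq hU hS]

lemma summable_measureReal_noIdle (h : IsInput P U S) (hU : MemLp (U 0) 2 P)
    (hS : Integrable (S 0) P) (hdrift : ∫ ω, S 0 ω ∂P < ∫ ω, U 0 ω ∂P) :
    Summable fun k => P.real (noIdle U S k) := by
  set D := ∫ ω, U 0 ω ∂P - ∫ ω, S 0 ω ∂P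
  have hD0 : 0 < D := sub_pos.2 hdrift
  set c := (∫ ω, U 0 ω ^ 2 ∂P + 1) / (2 * D) with hc
  have hc0 : 0 < c := by positivity
  have herr : (∫ ω, U 0 ω ^ 2 ∂P) / (4 * c) ≤ D / 2 := by
    rw [div_le_iff₀ (by positivity), hc]
    field_simp
    linarith
  have htel (n : ℕ) : D / 2 * ∑ k ∈ Finset.range n, P.real (noIdle U S k)
      + ∫ ω in noIdle U S n, (workloadBefore U S n ω + c) ∂P ≤ c := by
    induction n with
    | zero => simp [noIdle_zero, workloadBefore]
    | succ n ih =>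
      rw [Finset.sum_range_succ]
      have hstep := h.setIntegral_noIdle_succ_le hU hS hc0 n
      have hmul := mul_le_mul_of_nonneg_left herr (measureReal_nonneg (μ := P) (s := noIdle U S n))
      linear_combination ih + hstep + hmul
  refine summable_of_sum_range_le (c := c / (D / 2)) (fun _ => measureReal_nonneg) fun n => ?_
  rw [le_div_iff₀' (by positivity)]
  have : 0 ≤ ∫ ω in noIdle U S n, (workloadBefore U S n ω + c) ∂P :=
    integral_nonneg fun ω => add_nonneg (workloadBefore_nonneg U S n ω) hc0.le
  linarith [htel n]

lemma ae_exists_mem_firstIdle (h : IsInput P U S) (hU : MemLp (U 0) 2 P)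
    (hS : Integrable (S 0) P) (hdrift : ∫ ω, S 0 ω ∂P < ∫ ω, U 0 ω ∂P) :
    ∀ᵐ ω ∂P, ∃ K, ω ∈ firstIdle U S K := by
  have hsum : ∑' k, P (noIdle U S k) ≠ ⊤ := by
    simpa using (h.summable_measureReal_noIdle hU hS hdrift).tsum_ofReal_ne_top
  filter_upwards [ae_eventually_notMem hsum] with ω hω
  exact exists_mem_firstIdle hω.exists.choose_spec

end Summability

section IdlePeriod

lemma ae_idleTime_le (h : IsInput P U S) (k : ℕ) : ∀ᵐ ω ∂P, idleTime U S k ω ≤ U k ω := by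
  filter_upwards [h.nonneg_interarrival k, h.nonneg_service k] with ω hU hS
  refine max_le ?_ hU
  rw [freeWorkload]
  linarith [workloadBefore_nonneg U S k ω]

lemma ae_norm_idleTime_pow_le (h : IsInput P U S) (p k : ℕ) :
    ∀ᵐ ω ∂P, ‖idleTime U S k ω ^ p‖ ≤ U k ω ^ p := by
  filter_upwards [h.ae_idleTime_le k] with ω hω
  have h0 := idleTime_nonneg U S k ω
  rw [Real.norm_of_nonneg (pow_nonneg h0 p)]
  exact pow_le_pow_left₀ h0 hω p

lemma integrable_interarrival_pow (h : IsInput P U S) {p : ℕ}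
    (hUp : Integrable (fun ω => U 0 ω ^ p) P) (k : ℕ) : Integrable (fun ω => U k ω ^ p) P :=
  ((h.identDistrib_interarrival k).comp (u := (· ^ p)) (by fun_prop)).integrable_iff.2 hUp

lemma integrable_idleTime_pow (h : IsInput P U S) {p : ℕ}
    (hUp : Integrable (fun ω => U 0 ω ^ p) P) (k : ℕ) :
    Integrable (fun ω => idleTime U S k ω ^ p) P :=
  (h.integrable_interarrival_pow hUp k).mono'
    ((h.measurable_idleTime k).pow_const p).aestronglyMeasurable (h.ae_norm_idleTime_pow_le p k)

lemma setIntegral_firstIdle_norm_idleTime_pow_le (h : IsInput P U S) {p : ℕ}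
    (hUp : Integrable (fun ω => U 0 ω ^ p) P) (k : ℕ) :
    ∫ ω in firstIdle U S k, ‖idleTime U S k ω ^ p‖ ∂P
      ≤ P.real (noIdle U S k) * ∫ ω, U 0 ω ^ p ∂P := by
  have hUk := h.integrable_interarrival_pow hUp k
  have hpow : ∀ᵐ ω ∂P, 0 ≤ U k ω ^ p := (h.nonneg_interarrival k).mono fun ω hω => pow_nonneg hω p
  calc ∫ ω in firstIdle U S k, ‖idleTime U S k ω ^ p‖ ∂P
      ≤ ∫ ω in firstIdle U S k, U k ω ^ p ∂P :=
        setIntegral_mono_ae (h.integrable_idleTime_pow hUp k).norm.integrableOn hUk.integrableOn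
          (h.ae_norm_idleTime_pow_le p k)
    _ ≤ ∫ ω in noIdle U S k, U k ω ^ p ∂P :=
        setIntegral_mono_set hUk.integrableOn (ae_restrict_of_ae hpow)
          Set.inter_subset_left.eventuallyLE
    _ = _ := h.setIntegral_past (φ := fun x => x.1 ^ p) (measurableSet_past_noIdle U S k)
        (by fun_prop)

lemma setIntegral_noIdle_idleTime_pow (h : IsInput P U S) {p : ℕ} (hp : p ≠ 0) (k : ℕ) :
    ∫ ω in noIdle U S k, idleTime U S k ω ^ p ∂P
      = ∫ ω in firstIdle U S k, idleTime U S k ω ^ p ∂P := by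
  refine setIntegral_eq_of_subset_of_forall_sdiff_eq_zero (s := firstIdle U S k)
    (f := fun ω => idleTime U S k ω ^ p) (h.measurableSet_noIdle k) Set.inter_subset_left
    fun ω hω => ?_
  have hfree : 0 ≤ freeWorkload U S k ω := not_lt.1 fun hneg => hω.2 ⟨hω.1, hneg⟩
  rw [idleTime_of_nonneg hfree, zero_pow hp]

lemma ae_idlePeriod_eq_idleTime (h : IsInput P U S) (k : ℕ) :
    ∀ᵐ ω ∂P, ω ∈ firstIdle U S k → idlePeriod U S ω = idleTime U S k ω := by
  filter_upwards [h.ae_nonneg] with ω hω hk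
  exact idlePeriod_of_mem_firstIdle hω.1 hω.2 hk

variable [IsProbabilityMeasure P]

lemma iUnion_firstIdle_ae_eq_univ (h : IsInput P U S) (hU : MemLp (U 0) 2 P)
    (hS : Integrable (S 0) P) (hdrift : ∫ ω, S 0 ω ∂P < ∫ ω, U 0 ω ∂P) :
    ⋃ k, firstIdle U S k =ᵐ[P] Set.univ := by
  refine eventuallyEq_univ.2 ?_
  filter_upwards [h.ae_exists_mem_firstIdle hU hS hdrift] with ω hω
  exact Set.mem_iUnion.2 hω

lemma integrable_idlePeriod_pow (h : IsInput P U S) (hU : MemLp (U 0) 2 P)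
    (hS : Integrable (S 0) P) (hdrift : ∫ ω, S 0 ω ∂P < ∫ ω, U 0 ω ∂P) {p : ℕ}
    (hUp : Integrable (fun ω => U 0 ω ^ p) P) :
    Integrable (fun ω => idlePeriod U S ω ^ p) P := by
  have heq (k : ℕ) : ∀ᵐ ω ∂P, ω ∈ firstIdle U S k →
      idleTime U S k ω ^ p = idlePeriod U S ω ^ p :=
    (h.ae_idlePeriod_eq_idleTime k).mono fun ω hω hk => by rw [hω hk]
  rw [← integrableOn_univ, ← integrableOn_congr_set_ae (h.iUnion_firstIdle_ae_eq_univ hU hS hdrift)]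
  refine integrableOn_iUnion_of_summable_integral_norm (fun k => ?_) ?_
  · exact (h.integrable_idleTime_pow hUp k).integrableOn.congr_fun_ae
      ((ae_restrict_iff' (h.measurableSet_firstIdle k)).2 (heq k))
  · refine Summable.of_nonneg_of_le (fun k => integral_nonneg fun ω => norm_nonneg _)
      (fun k => ?_) ((h.summable_measureReal_noIdle hU hS hdrift).mul_right (∫ ω, U 0 ω ^ p ∂P))
    rw [← setIntegral_congr_ae (h.measurableSet_firstIdle k)
      ((heq k).mono fun ω hω hk => congrArg norm (hω hk))]
    exact h.setIntegral_firstIdle_norm_idleTime_pow_le hUp k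

lemma hasSum_setIntegral_noIdle (h : IsInput P U S) (hU : MemLp (U 0) 2 P)
    (hS : Integrable (S 0) P) (hdrift : ∫ ω, S 0 ω ∂P < ∫ ω, U 0 ω ∂P) {p : ℕ} (hp : p ≠ 0)
    (hUp : Integrable (fun ω => U 0 ω ^ p) P) :
    HasSum (fun k => ∫ ω in noIdle U S k, idleTime U S k ω ^ p ∂P)
      (∫ ω, idlePeriod U S ω ^ p ∂P) := by
  have heq (k : ℕ) : ∫ ω in noIdle U S k, idleTime U S k ω ^ p ∂P
      = ∫ ω in firstIdle U S k, idlePeriod U S ω ^ p ∂P := by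
    rw [h.setIntegral_noIdle_idleTime_pow hp]
    refine setIntegral_congr_ae (h.measurableSet_firstIdle k) ?_
    exact (h.ae_idlePeriod_eq_idleTime k).mono fun ω hω hk => by rw [hω hk]
  simp_rw [heq]
  rw [← setIntegral_univ,
    ← setIntegral_congr_set (h.iUnion_firstIdle_ae_eq_univ hU hS hdrift)]
  exact hasSum_integral_iUnion h.measurableSet_firstIdle (pairwise_disjoint_firstIdle U S)
    (h.integrable_idlePeriod_pow hU hS hdrift hUp).integrableOn

lemma integral_idlePeriod_pos (h : IsInput P U S) (hU : MemLp (U 0) 2 P)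
    (hS : Integrable (S 0) P) (hdrift : ∫ ω, S 0 ω ∂P < ∫ ω, U 0 ω ∂P) :
    0 < ∫ ω, idlePeriod U S ω ∂P := by
  have hint : Integrable (idlePeriod U S) P := by
    simpa using h.integrable_idlePeriod_pow hU hS hdrift (p := 1)
      (by simpa using hU.integrable one_le_two)
  have hpos : ∀ᵐ ω ∂P, 0 < idlePeriod U S ω := by
    filter_upwards [h.ae_nonneg, h.ae_exists_mem_firstIdle hU hS hdrift] with ω hω ⟨K, hK⟩
    rw [idlePeriod_of_mem_firstIdle hω.1 hω.2 hK, idleTime_of_neg hK.2]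
    exact neg_pos.2 hK.2
  refine (integral_pos_iff_support_of_nonneg_ae (hpos.mono fun _ => le_of_lt) hint).2 ?_
  have hsupport : Function.support (idlePeriod U S) =ᵐ[P] Set.univ :=
    eventuallyEq_univ.2 (hpos.mono fun _ => ne_of_gt)
  rw [measure_congr hsupport, measure_univ]
  exact one_pos

end IdlePeriod

end IsInput

section Renewal

variable {U S : ℕ → Ω → ℝ}

/-- The event that customer `k` is the first customer of a busy period. -/
def busyStart (U S : ℕ → Ω → ℝ) : ℕ → Set Ω
  | 0 => Set.univ
  | k + 1 => {ω | freeWorkload U S k ω < 0}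

/-- The event that customer `j` starts a busy period and no idling follows before customer
`j + i`, written through the queue that starts with customer `j`. -/
def busyFor (U S : ℕ → Ω → ℝ) (j i : ℕ) : Set Ω :=
  busyStart U S j ∩ inputPath U S j ⁻¹' noIdle (fun n x => x (.inl n)) (fun n x => x (.inr n)) i

lemma measurableSet_past_busyStart (U S : ℕ → Ω → ℝ) :
    ∀ k, MeasurableSet[past U S k] (busyStart U S k)
  | 0 => MeasurableSet.univ
  | k + 1 => measurable_past_freeWorkload k measurableSet_Iio

lemma workloadBefore_inputPath {j : ℕ} {ω : Ω} (hω : ω ∈ busyStart U S j) (i : ℕ) :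
    workloadBefore (fun n x => x (.inl n)) (fun n x => x (.inr n)) i (inputPath U S j ω)
      = workloadBefore U S (j + i) ω := by
  induction i with
  | zero =>
    cases j with
    | zero => rfl
    | succ j => exact (workloadBefore_succ_of_neg hω).symm
  | succ i ih => rw [workloadBefore, ih]; rfl

lemma freeWorkload_inputPath {j : ℕ} {ω : Ω} (hω : ω ∈ busyStart U S j) (i : ℕ) :
    freeWorkload (fun n x => x (.inl n)) (fun n x => x (.inr n)) i (inputPath U S j ω)
      = freeWorkload U S (j + i) ω := by
  rw [freeWorkload, workloadBefore_inputPath hω]; rfl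

lemma idleTime_inputPath {j : ℕ} {ω : Ω} (hω : ω ∈ busyStart U S j) (i : ℕ) :
    idleTime (fun n x => x (.inl n)) (fun n x => x (.inr n)) i (inputPath U S j ω)
      = idleTime U S (j + i) ω := by
  rw [idleTime, freeWorkload_inputPath hω, idleTime]

lemma mem_busyFor_succ {j i : ℕ} {ω : Ω} :
    ω ∈ busyFor U S j (i + 1) ↔ ω ∈ busyFor U S j i ∧ 0 ≤ freeWorkload U S (j + i) ω := by
  simp only [busyFor, noIdle_succ, Set.mem_inter_iff, Set.mem_preimage, and_assoc]
  exact and_congr_right fun hω => and_congr_right fun _ => by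
    rw [← freeWorkload_inputPath hω]; rfl

lemma busyFor_zero_left (U S : ℕ → Ω → ℝ) (i : ℕ) : busyFor U S 0 i = noIdle U S i := by
  ext ω
  have hω : ω ∈ busyStart U S 0 := Set.mem_univ ω
  simp only [busyFor, noIdle, Set.mem_inter_iff, hω, true_and, Set.mem_preimage, Set.mem_ofPred_eq]
  simp [freeWorkload_inputPath hω]

lemma busyFor_zero_right (U S : ℕ → Ω → ℝ) (j : ℕ) : busyFor U S j 0 = busyStart U S j := by
  simp [busyFor, noIdle_zero]

lemma sum_indicator_busyFor (U S : ℕ → Ω → ℝ) (f : Ω → ℝ) (k : ℕ) (ω : Ω) :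
    ∑ j ∈ Finset.range (k + 1), (busyFor U S j (k - j)).indicator f ω = f ω := by
  classical
  induction k with
  | zero => simp [busyFor_zero_right, busyStart]
  | succ k ih =>
    have hmem : ∀ j ∈ Finset.range (k + 1), ω ∈ busyFor U S j (k + 1 - j) ↔
        ω ∈ busyFor U S j (k - j) ∧ 0 ≤ freeWorkload U S k ω := fun j hj => by
      have hjk : j ≤ k := Finset.mem_range_succ_iff.1 hj
      rw [Nat.succ_sub hjk, mem_busyFor_succ, Nat.add_sub_cancel' hjk]
    rw [Finset.sum_range_succ, Nat.sub_self, busyFor_zero_right]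
    rcases lt_or_ge (freeWorkload U S k ω) 0 with hneg | hnonneg
    · have hstart : ω ∈ busyStart U S (k + 1) := hneg
      rw [Finset.sum_eq_zero fun j hj => Set.indicator_of_notMem
          (fun hω => hneg.not_ge ((hmem j hj).1 hω).2) f, zero_add,
        Set.indicator_of_mem hstart]
    · have hstart : ω ∉ busyStart U S (k + 1) := not_lt.2 hnonneg
      rw [Set.indicator_of_notMem hstart, add_zero, ← ih]
      refine Finset.sum_congr rfl fun j hj => ?_
      simp only [Set.indicator_apply, hmem j hj, hnonneg, and_true]

end Renewal

namespace IsInput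

variable [MeasurableSpace Ω] {P : Measure Ω} {U S : ℕ → Ω → ℝ}

lemma setIntegral_busyFor_idleTime_pow (h : IsInput P U S) (p j i : ℕ) :
    ∫ ω in busyFor U S j i, idleTime U S (j + i) ω ^ p ∂P
      = P.real (busyStart U S j) * ∫ ω in noIdle U S i, idleTime U S i ω ^ p ∂P := by
  classical
  have hpast := GG1.past_le (fun n => measurable_pi_apply (Sum.inl n : ℕ ⊕ ℕ))
    fun n => measurable_pi_apply (X := fun _ => ℝ) (Sum.inr n : ℕ ⊕ ℕ)
  have hnoIdle := hpast i _ (measurableSet_past_noIdle _ _ i)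
  set reward : (ℕ ⊕ ℕ → ℝ) → ℝ :=
    (noIdle (fun n x => x (.inl n)) (fun n x => x (.inr n)) i).indicator
      fun x => idleTime (fun n x => x (.inl n)) (fun n x => x (.inr n)) i x ^ p with hreward
  have hmeas : Measurable reward :=
    ((((measurable_past_freeWorkload i).mono (hpast (i + 1)) le_rfl).neg.max
      measurable_const).pow_const p).indicator hnoIdle
  have heq (j : ℕ) : ∫ ω in busyFor U S j i, idleTime U S (j + i) ω ^ p ∂P
      = ∫ ω in busyStart U S j, reward (inputPath U S j ω) ∂P := by
    rw [busyFor, ← setIntegral_indicator (h.measurable_inputPath j hnoIdle)]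
    refine setIntegral_congr_fun (h.past_le j _ (measurableSet_past_busyStart U S j)) fun ω hω => ?_
    simp only [hreward, Set.indicator_apply, Set.mem_preimage, idleTime_inputPath hω]
  have hzero := heq 0
  rw [busyFor_zero_left, zero_add] at hzero
  rw [heq, h.setIntegral_past_inputPath (measurableSet_past_busyStart U S j) hmeas, hzero,
    busyStart, setIntegral_univ]

lemma integral_idleTime_pow_eq_sum (h : IsInput P U S) {p : ℕ}
    (hUp : Integrable (fun ω => U 0 ω ^ p) P) (k : ℕ) :
    ∫ ω, idleTime U S k ω ^ p ∂P = ∑ j ∈ Finset.range (k + 1),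
      P.real (busyStart U S j) * ∫ ω in noIdle U S (k - j), idleTime U S (k - j) ω ^ p ∂P := by
  have hmeas (j i : ℕ) : MeasurableSet (busyFor U S j i) :=
    (h.past_le j _ (measurableSet_past_busyStart U S j)).inter <| h.measurable_inputPath j <|
      GG1.past_le (fun n => measurable_pi_apply _) (fun n => measurable_pi_apply _) i _
        (measurableSet_past_noIdle _ _ i)
  rw [← integral_congr_ae (ae_of_all P (sum_indicator_busyFor U S (idleTime U S k · ^ p) k)),
    integral_finsetSum _ fun j _ => (h.integrable_idleTime_pow hUp k).indicator (hmeas j _)]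
  refine Finset.sum_congr rfl fun j hj => ?_
  rw [integral_indicator (hmeas j _), ← h.setIntegral_busyFor_idleTime_pow,
    Nat.add_sub_cancel' (Finset.mem_range_succ_iff.1 hj)]

end IsInput

lemma tendsto_cesaro_sub_convolution {u a e : ℕ → ℝ} {A : ℝ} (hu0 : ∀ j, 0 ≤ u j)
    (hu1 : ∀ j, u j ≤ 1) (ha0 : ∀ i, 0 ≤ a i) (ha : HasSum a A)
    (he : ∀ k, e k = ∑ j ∈ Finset.range (k + 1), u j * a (k - j)) :
    Tendsto (fun n : ℕ => A * ((n : ℝ)⁻¹ * ∑ j ∈ Finset.range n, u j)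
      - (n : ℝ)⁻¹ * ∑ k ∈ Finset.range n, e k) atTop (𝓝 0) := by
  set tail : ℕ → ℝ := fun n => A - ∑ i ∈ Finset.range n, a i with htail
  have htail0 (n : ℕ) : 0 ≤ tail n := sub_nonneg.2 (sum_le_hasSum _ (fun i _ => ha0 i) ha)
  have hcesaro : Tendsto (fun n : ℕ => (n : ℝ)⁻¹ * ∑ i ∈ Finset.range n, tail (i + 1))
      atTop (𝓝 0) := by
    have htendsto : Tendsto tail atTop (𝓝 0) := by
      simpa using ha.tendsto_sum_nat.const_sub A
    exact (htendsto.comp (tendsto_add_atTop_nat 1)).cesaro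
  have hdiff (n : ℕ) : A * ((n : ℝ)⁻¹ * ∑ j ∈ Finset.range n, u j)
      - (n : ℝ)⁻¹ * ∑ k ∈ Finset.range n, e k
      = (n : ℝ)⁻¹ * ∑ j ∈ Finset.range n, u j * tail (n - j) := by
    have hsum : ∑ k ∈ Finset.range n, e k
        = ∑ j ∈ Finset.range n, u j * ∑ i ∈ Finset.range (n - j), a i := by
      simp_rw [he, Finset.mul_sum]
      exact Finset.sum_range_diag_flip n fun j i => u j * a i
    simp_rw [hsum, htail, mul_sub, Finset.sum_sub_distrib, ← Finset.sum_mul]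
    ring
  refine squeeze_zero (fun n => ?_) (fun n => ?_) hcesaro <;> rw [hdiff]
  · exact mul_nonneg (by positivity)
      (Finset.sum_nonneg fun j _ => mul_nonneg (hu0 j) (htail0 _))
  · rw [← Finset.sum_range_reflect fun i => tail (i + 1)]
    refine mul_le_mul_of_nonneg_left (Finset.sum_le_sum fun j hj => ?_) (by positivity)
    have hj : j < n := Finset.mem_range.1 hj
    rw [show n - 1 - j + 1 = n - j by omega]
    exact mul_le_of_le_one_left (htail0 _) (hu1 j)

namespace IsInput

variable [MeasurableSpace Ω] {P : Measure Ω} [IsProbabilityMeasure P] {U S : ℕ → Ω → ℝ}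

lemma tendsto_sum_integral_idleTime_pow_sub (h : IsInput P U S) (hU : MemLp (U 0) 2 P)
    (hS : Integrable (S 0) P) (hdrift : ∫ ω, S 0 ω ∂P < ∫ ω, U 0 ω ∂P) {p : ℕ} (hp : p ≠ 0)
    (hUp : Integrable (fun ω => U 0 ω ^ p) P) :
    Tendsto (fun n : ℕ => (∫ ω, idlePeriod U S ω ^ p ∂P) *
      ((n : ℝ)⁻¹ * ∑ j ∈ Finset.range n, P.real (busyStart U S j))
      - (n : ℝ)⁻¹ * ∑ k ∈ Finset.range n, ∫ ω, idleTime U S k ω ^ p ∂P) atTop (𝓝 0) :=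
  tendsto_cesaro_sub_convolution (fun _ => measureReal_nonneg) (fun _ => measureReal_le_one)
    (fun i => integral_nonneg fun ω => pow_nonneg (idleTime_nonneg U S i ω) p)
    (h.hasSum_setIntegral_noIdle hU hS hdrift hp hUp) (h.integral_idleTime_pow_eq_sum hUp)

/-- By the renewal reward theorem, both averages of powers of idle times are proportional to the
corresponding moment of the idle period, with the same factor: the rate of busy periods. -/
lemma tendsto_sum_integral_sq_idleTime (h : IsInput P U S) (hU : MemLp (U 0) 2 P)
    (hS : MemLp (S 0) 2 P) (hdrift : ∫ ω, S 0 ω ∂P < ∫ ω, U 0 ω ∂P) :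
    Tendsto (fun n : ℕ => (n : ℝ)⁻¹ * ∑ k ∈ Finset.range n, ∫ ω, idleTime U S k ω ^ 2 ∂P) atTop
      (𝓝 ((∫ ω, U 0 ω ∂P - ∫ ω, S 0 ω ∂P) *
        ((∫ ω, idlePeriod U S ω ^ 2 ∂P) / ∫ ω, idlePeriod U S ω ∂P))) := by
  have hS1 := hS.integrable one_le_two
  have hpos := h.integral_idlePeriod_pos hU hS1 hdrift
  have hfirst := h.tendsto_sum_integral_idleTime_pow_sub hU hS1 hdrift one_ne_zero
    (by simpa using hU.integrable one_le_two)
  simp only [pow_one] at hfirst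
  have hrate : Tendsto (fun n : ℕ => (n : ℝ)⁻¹ * ∑ j ∈ Finset.range n, P.real (busyStart U S j))
      atTop (𝓝 ((∫ ω, U 0 ω ∂P - ∫ ω, S 0 ω ∂P) / ∫ ω, idlePeriod U S ω ∂P)) := by
    have hsum := (hfirst.add (h.tendsto_sum_integral_idleTime hU hS hdrift.le)).div_const
      (∫ ω, idlePeriod U S ω ∂P)
    simpa only [sub_add_cancel, mul_div_cancel_left₀ _ hpos.ne', zero_add] using hsum
  have hsecond := (hrate.const_mul (∫ ω, idlePeriod U S ω ^ 2 ∂P)).sub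
    (h.tendsto_sum_integral_idleTime_pow_sub hU hS1 hdrift two_ne_zero hU.integrable_sq)
  simp only [sub_sub_cancel, sub_zero] at hsecond
  convert hsecond using 2
  ring

end IsInput

section Exponential

open scoped NNReal

variable {r M : ℝ} {h : ℝ → ℝ}

lemma toReal_exponentialPDF_eq_indicator (hr : 0 < r) :
    (fun y => (exponentialPDF r y).toReal)
      = (Set.Ici 0).indicator fun y => r * Real.exp (-(r * y)) := by
  funext y
  by_cases hy : 0 ≤ y
  · rw [Set.indicator_of_mem (Set.mem_Ici.2 hy), exponentialPDF_of_nonneg hy,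
      ENNReal.toReal_ofReal (by positivity)]
  · rw [Set.indicator_of_notMem (by simpa using hy), exponentialPDF_of_neg (not_le.1 hy),
      ENNReal.toReal_zero]

lemma measurable_exponentialPDF (r : ℝ) : Measurable (exponentialPDF r) :=
  (measurable_gammaPDFReal 1 r).ennreal_ofReal

lemma integral_expMeasure (hr : 0 < r) (f : ℝ → ℝ) :
    ∫ y, f y ∂(expMeasure r) = ∫ y in Set.Ioi 0, r * Real.exp (-(r * y)) * f y := by
  have hdensity : ∫ y, f y ∂(expMeasure r) = ∫ y, (exponentialPDF r y).toReal * f y :=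
    integral_withDensity_eq_integral_toReal_smul (measurable_exponentialPDF r)
      (ae_of_all _ fun _ => ENNReal.ofReal_lt_top) f
  rw [hdensity, ← integral_Ici_eq_integral_Ioi, ← integral_indicator measurableSet_Ici]
  refine integral_congr_ae (ae_of_all _ fun y => ?_)
  simp only [congrFun (toReal_exponentialPDF_eq_indicator hr) y, Set.indicator_mul_left]

lemma integrable_id_expMeasure (hr : 0 < r) : Integrable (fun y : ℝ => y) (expMeasure r) := by
  have hgamma : IntegrableOn (fun y : ℝ => r * (y ^ (1 : ℝ) * Real.exp (-r * y ^ (1 : ℝ))))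
      (Set.Ioi 0) :=
    (integrableOn_rpow_mul_exp_neg_mul_rpow (by norm_num) one_pos hr).const_mul r
  rw [← integrableOn_Ici_iff_integrableOn_Ioi, ← integrable_indicator_iff measurableSet_Ici]
    at hgamma
  refine (integrable_withDensity_iff_integrable_smul' (measurable_exponentialPDF r)
    (ae_of_all _ fun _ => ENNReal.ofReal_lt_top)).2 (hgamma.congr (ae_of_all _ fun y => ?_))
  simp only [Real.rpow_one, smul_eq_mul, congrFun (toReal_exponentialPDF_eq_indicator hr) y]
  refine Eq.trans ?_ (Set.indicator_mul_left (Set.Ici 0) _ fun y : ℝ => y)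
  congr 1
  funext z
  ring_nf

/-- The solution `q` of the Stein equation `q' = r (q + h - 𝔼 h(Y))` of the exponential law of rate
`r`, where `Y` has this law; it is the solution that remains bounded when `h` is bounded. -/
def steinSolution (r : ℝ) (h : ℝ → ℝ) (x : ℝ) : ℝ :=
  ∫ y, h y ∂(expMeasure r) - ∫ y, h (x + y) ∂(expMeasure r)

lemma steinSolution_zero (r : ℝ) (h : ℝ → ℝ) : steinSolution r h 0 = 0 := by
  simp only [steinSolution, zero_add, sub_self]

lemma lipschitzWith_steinSolution {K : ℝ≥0} (hr : 0 < r) (hK : LipschitzWith K h)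
    (hM : ∀ x, |h x| ≤ M) : LipschitzWith K (steinSolution r h) := by
  have := isProbabilityMeasure_expMeasure hr
  have hcont := hK.continuous
  have hint : ∀ x, Integrable (fun y => h (x + y)) (expMeasure r) := fun x =>
    .of_bound (by fun_prop) M (ae_of_all _ fun y => hM _)
  refine LipschitzWith.of_dist_le_mul fun x z => ?_
  have hpoint : ∀ y, ‖h (z + y) - h (x + y)‖ ≤ K * dist x z := fun y => by
    simpa [dist_eq_norm, norm_sub_rev] using hK.dist_le_mul (z + y) (x + y)
  rw [dist_eq_norm (steinSolution r h x), steinSolution, steinSolution, sub_sub_sub_cancel_left,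
    ← integral_sub (hint z) (hint x)]
  simpa only [probReal_univ, mul_one] using
    norm_integral_le_of_norm_le_const (μ := expMeasure r) (ae_of_all _ hpoint)

lemma abs_steinSolution_le (hr : 0 < r) (hM : ∀ x, |h x| ≤ M) (x : ℝ) :
    |steinSolution r h x| ≤ 2 * M := by
  have := isProbabilityMeasure_expMeasure hr
  have hmean : ∀ x, |∫ y, h (x + y) ∂(expMeasure r)| ≤ M := fun x => by
    simpa using norm_integral_le_of_norm_le_const (μ := expMeasure r) (C := M)
      (f := fun y => h (x + y)) (ae_of_all _ fun y => hM (x + y))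
  calc |steinSolution r h x|
      ≤ |∫ y, h y ∂(expMeasure r)| + |∫ y, h (x + y) ∂(expMeasure r)| := abs_sub _ _
    _ ≤ M + M := add_le_add (by simpa only [zero_add] using hmean 0) (hmean x)
    _ = 2 * M := (two_mul M).symm

lemma integrableOn_exp_neg_mul_mul (hr : 0 < r) (hcont : Continuous h) (hM : ∀ x, |h x| ≤ M)
    (a : ℝ) : IntegrableOn (fun z => r * Real.exp (-(r * z)) * h z) (Set.Ioi a) := by
  have hexp : IntegrableOn (fun z => r * Real.exp (-(r * z))) (Set.Ioi a) := by
    simp only [← neg_mul]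
    exact (exp_neg_integrableOn_Ioi a hr).const_mul r
  exact hexp.mul_bdd (c := M) (by fun_prop) (ae_of_all _ hM)

lemma integral_comp_add_expMeasure (hr : 0 < r) (hcont : Continuous h) (hM : ∀ x, |h x| ≤ M)
    (x : ℝ) : ∫ y, h (x + y) ∂(expMeasure r)
      = Real.exp (r * x) * (∫ y, h y ∂(expMeasure r)
        - ∫ z in (0 : ℝ)..x, r * Real.exp (-(r * z)) * h z) := by
  have hint := integrableOn_exp_neg_mul_mul hr hcont hM
  have htail : ∫ y, h y ∂(expMeasure r) - ∫ z in (0 : ℝ)..x, r * Real.exp (-(r * z)) * h z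
      = ∫ z in Set.Ioi x, r * Real.exp (-(r * z)) * h z := by
    rw [integral_expMeasure hr, ← intervalIntegral.integral_Ioi_sub_Ioi' (hint 0) (hint x),
      sub_sub_cancel]
  have hshift := (measurePreserving_add_left volume x).setIntegral_preimage_emb
    (measurableEmbedding_addLeft x) (fun z => r * Real.exp (-(r * z)) * h z) (Set.Ioi x)
  rw [Set.preimage_const_add_Ioi, sub_self] at hshift
  rw [htail, ← hshift, integral_expMeasure hr, ← integral_const_mul]
  congr 1
  funext y
  rw [show -(r * y) = r * x + -(r * (x + y)) by ring, Real.exp_add]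
  ring

lemma hasDerivAt_steinSolution (hr : 0 < r) (hcont : Continuous h) (hM : ∀ x, |h x| ≤ M) (x : ℝ) :
    HasDerivAt (steinSolution r h)
      (r * (steinSolution r h x + h x - ∫ y, h y ∂(expMeasure r))) x := by
  have hformula : steinSolution r h = fun x => ∫ y, h y ∂(expMeasure r)
      - Real.exp (r * x) * (∫ y, h y ∂(expMeasure r)
        - ∫ z in (0 : ℝ)..x, r * Real.exp (-(r * z)) * h z) := by
    funext x
    rw [steinSolution, integral_comp_add_expMeasure hr hcont hM]
  have hdensity : Continuous fun z => r * Real.exp (-(r * z)) * h z := by fun_prop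
  have hintegral := (hdensity.integral_hasStrictDerivAt 0 x).hasDerivAt
  have hexp : HasDerivAt (fun x => Real.exp (r * x)) (Real.exp (r * x) * (r * 1)) x :=
    ((hasDerivAt_id x).const_mul r).exp
  rw [hformula]
  refine ((hexp.mul (hintegral.const_sub (∫ y, h y ∂(expMeasure r)))).const_sub
    (∫ y, h y ∂(expMeasure r))).congr_deriv ?_
  have hcancel : Real.exp (r * x) * Real.exp (-(r * x)) = 1 := by
    rw [← Real.exp_add, add_neg_cancel, Real.exp_zero]
  linear_combination (r * h x) * hcancel

end Exponential

section Deterministic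

open scoped NNReal

variable {F G D : ℝ → ℝ} {L C : ℝ≥0} {K ρ κ : ℝ}

lemma abs_intervalIntegral_le_of_abs_le_pow {φ : ℝ → ℝ} {n : ℕ} (h : ∀ y, |φ y| ≤ K * |y| ^ n)
    (x : ℝ) : |∫ y in (0 : ℝ)..x, φ y| ≤ K * (|x| ^ (n + 1) / (n + 1)) := by
  have hpow := integral_pow_abs_sub_uIoc (a := 0) (b := x) n
  simp only [sub_zero] at hpow
  have hint : IntegrableOn (fun y : ℝ => K * |y| ^ n) (Set.uIoc 0 x) :=
    (Continuous.intervalIntegrable (by fun_prop) 0 x).def'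
  calc ‖∫ y in (0 : ℝ)..x, φ y‖
      ≤ ∫ y in Set.uIoc 0 x, ‖φ y‖ := intervalIntegral.norm_integral_le_integral_norm_uIoc
    _ ≤ ∫ y in Set.uIoc 0 x, K * |y| ^ n :=
        integral_mono_of_nonneg (ae_of_all _ fun y => norm_nonneg _) hint (ae_of_all _ h)
    _ = K * (|x| ^ (n + 1) / (n + 1)) := by rw [integral_const_mul, hpow]

lemma abs_taylor_one_le (hF : ∀ x, HasDerivAt F (G x) x) (hL : LipschitzWith L G) (w x : ℝ) :
    |F (w + x) - F w - G w * x| ≤ L * (|x| ^ 2 / 2) := by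
  have hG := hL.continuous
  have hremainder : F (w + x) - F w - G w * x = ∫ y in (0 : ℝ)..x, (G (w + y) - G w) := by
    rw [intervalIntegral.integral_sub (Continuous.intervalIntegrable (by fun_prop) _ _) (by simp),
      intervalIntegral.integral_eq_sub_of_hasDerivAt (f := fun y => F (w + y))
        (fun y _ => (hF (w + y)).comp_const_add w y)
        (Continuous.intervalIntegrable (by fun_prop) _ _)]
    simp [mul_comm]
  rw [hremainder]
  have h := abs_intervalIntegral_le_of_abs_le_pow (φ := fun y => G (w + y) - G w) (K := L)
    (n := 1) (fun y => by simpa [Real.dist_eq] using hL.dist_le_mul (w + y) w) x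
  norm_num at h
  simpa only [sq_abs] using h

lemma abs_taylor_two_le (hF : ∀ x, HasDerivAt F (G x) x) (hG : ∀ x, HasDerivAt G (D x) x)
    (hC : LipschitzWith C D) (w x : ℝ) :
    |F (w + x) - F w - G w * x - D w * (x ^ 2 / 2)| ≤ C / 2 * (|x| ^ 3 / 3) := by
  have hGc : Continuous G := continuous_iff_continuousAt.2 fun x => (hG x).continuousAt
  have hremainder : F (w + x) - F w - G w * x - D w * (x ^ 2 / 2)
      = ∫ y in (0 : ℝ)..x, (G (w + y) - G w - D w * y) := by
    rw [intervalIntegral.integral_sub (Continuous.intervalIntegrable (by fun_prop) _ _)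
        (Continuous.intervalIntegrable (by fun_prop) _ _),
      intervalIntegral.integral_sub (Continuous.intervalIntegrable (by fun_prop) _ _) (by simp),
      intervalIntegral.integral_eq_sub_of_hasDerivAt (f := fun y => F (w + y))
        (fun y _ => (hF (w + y)).comp_const_add w y)
        (Continuous.intervalIntegrable (by fun_prop) _ _)]
    simp [mul_comm]
  rw [hremainder]
  have h := abs_intervalIntegral_le_of_abs_le_pow (φ := fun y => G (w + y) - G w - D w * y)
    (K := C / 2) (n := 2) (fun y => (abs_taylor_one_le hG hC w y).trans_eq (by ring)) x
  norm_num at h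
  exact h

/-- The workload a time `s` into a cycle that starts with an arrival to the workload `v`, this
arrival included. -/
def drain (v s : ℝ) : ℝ := max (v - s) 0

@[fun_prop]
lemma continuous_drain (v : ℝ) : Continuous (drain v) := by unfold drain; fun_prop

lemma integral_comp_max_zero (hF : ∀ x, HasDerivAt F (G x) x) (hGc : Continuous G)
    (hG0 : G 0 = 0) (a b : ℝ) :
    ∫ y in a..b, G (max y 0) = F (max b 0) - F (max a 0) := by
  have hfrom_zero : ∀ b, ∫ y in (0 : ℝ)..b, G (max y 0) = F (max b 0) - F 0 := fun b => by
    rcases le_total 0 b with hb | hb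
    · rw [max_eq_left hb, ← intervalIntegral.integral_eq_sub_of_hasDerivAt (fun y _ => hF y)
        (hGc.intervalIntegrable 0 b)]
      refine intervalIntegral.integral_congr fun y hy => ?_
      rw [Set.uIcc_of_le hb] at hy
      simp only [max_eq_left hy.1]
    · rw [max_eq_right hb, sub_self]
      refine (intervalIntegral.integral_congr (g := fun _ => 0) fun y hy => ?_).trans
        intervalIntegral.integral_zero
      rw [Set.uIcc_of_ge hb] at hy
      simp only [max_eq_right hy.2, hG0]
  have hint : ∀ a b, IntervalIntegrable (fun y => G (max y 0)) volume a b := fun a b =>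
    Continuous.intervalIntegrable (by fun_prop) a b
  rw [← intervalIntegral.integral_interval_sub_left (hint 0 b) (hint 0 a), hfrom_zero, hfrom_zero,
    sub_sub_sub_cancel_right]

/- Changing variables, the increment of `F` over the shift from `v - ρ u` to `v - u` is also an
integral over `[0, u]`, of `G` along a path that moves at speed `1 - ρ` and stays at distance
`ρ (u - s)` from the draining path. -/
lemma abs_sub_add_integral_drain_le (hF : ∀ x, HasDerivAt F (G x) x) (hL : LipschitzWith L G)
    (hG0 : G 0 = 0) (hρ0 : 0 ≤ ρ) (hρ1 : ρ ≤ 1) (v : ℝ) {u : ℝ} (hu : 0 ≤ u) :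
    |F (drain v u) - F (max (v - ρ * u) 0) + (1 - ρ) * ∫ s in (0 : ℝ)..u, G (drain v s)|
      ≤ (1 - ρ) * (ρ * L * (u ^ 2 / 2)) := by
  have hGc := hL.continuous
  have hδ : 0 ≤ 1 - ρ := sub_nonneg.2 hρ1
  have hchange : F (max (v - ρ * u) 0) - F (drain v u)
      = (1 - ρ) * ∫ s in (0 : ℝ)..u, G (max (v - ρ * u - (1 - ρ) * s) 0) := by
    rw [intervalIntegral.mul_integral_comp_sub_mul (f := fun y => G (max y 0)),
      integral_comp_max_zero hF hGc hG0, drain]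
    ring_nf
  have hcombine : F (drain v u) - F (max (v - ρ * u) 0) + (1 - ρ) * ∫ s in (0 : ℝ)..u, G (drain v s)
      = (1 - ρ) * ∫ s in (0 : ℝ)..u, (G (drain v s) - G (max (v - ρ * u - (1 - ρ) * s) 0)) := by
    rw [intervalIntegral.integral_sub (Continuous.intervalIntegrable (by fun_prop) _ _)
      (Continuous.intervalIntegrable (by fun_prop) _ _)]
    linear_combination -hchange
  have hpoint : ∀ s ∈ Set.Ioc 0 u,
      ‖G (drain v s) - G (max (v - ρ * u - (1 - ρ) * s) 0)‖ ≤ ρ * L * (u - s) := fun s hs => by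
    calc ‖G (drain v s) - G (max (v - ρ * u - (1 - ρ) * s) 0)‖
        ≤ L * |drain v s - max (v - ρ * u - (1 - ρ) * s) 0| := hL.dist_le_mul _ _
      _ ≤ L * |v - s - (v - ρ * u - (1 - ρ) * s)| :=
          mul_le_mul_of_nonneg_left (abs_max_sub_max_le_abs _ _ _) L.coe_nonneg
      _ = ρ * L * (u - s) := by
          rw [show v - s - (v - ρ * u - (1 - ρ) * s) = ρ * (u - s) by ring,
            abs_of_nonneg (mul_nonneg hρ0 (sub_nonneg.2 hs.2))]
          ring
  rw [hcombine, abs_mul, abs_of_nonneg hδ]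
  gcongr
  refine (intervalIntegral.norm_integral_le_of_norm_le hu (ae_of_all _ hpoint)
    (Continuous.intervalIntegrable (by fun_prop) _ _)).trans_eq ?_
  rw [intervalIntegral.integral_const_mul, intervalIntegral.integral_sub (by simp) (by simp)]
  simp only [intervalIntegral.integral_const, integral_id, smul_eq_mul, sub_zero]
  ring

lemma abs_comp_max_sub_comp_le (hF : ∀ x, HasDerivAt F (G x) x) (hL : LipschitzWith L G)
    (hG0 : G 0 = 0) (hρ0 : 0 ≤ ρ) (hρ1 : ρ ≤ 1) {v : ℝ} (hv : 0 ≤ v) (u : ℝ) :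
    |F (max (v - ρ * u) 0) - F (v - ρ * u)| ≤ ρ * L / 2 * max (u - v) 0 ^ 2 := by
  rcases le_total 0 (v - ρ * u) with hpos | hneg
  · rw [max_eq_left hpos, sub_self, abs_zero]
    positivity
  have hvu : ρ * u - v ≤ ρ * max (u - v) 0 := by
    nlinarith [mul_le_mul_of_nonneg_left (le_max_left (u - v) 0) hρ0,
      mul_nonneg (sub_nonneg.2 hρ1) hv]
  rw [max_eq_right hneg]
  calc |F 0 - F (v - ρ * u)|
      ≤ L * (|v - ρ * u| ^ 2 / 2) := by
        simpa [hG0, abs_sub_comm] using abs_taylor_one_le hF hL 0 (v - ρ * u)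
    _ ≤ L * ((ρ * max (u - v) 0) ^ 2 / 2) := by
        rw [abs_of_nonpos hneg]
        gcongr <;> linarith
    _ = ρ * (ρ * L / 2 * max (u - v) 0 ^ 2) := by ring
    _ ≤ ρ * L / 2 * max (u - v) 0 ^ 2 := mul_le_of_le_one_left (by positivity) hρ1

lemma abs_mul_sub_integral_drain_le (hC : LipschitzWith C D) {w s u : ℝ} (hw : 0 ≤ w)
    (hs : 0 ≤ s) (hu : 0 ≤ u) :
    |D w * u - ∫ t in (0 : ℝ)..u, D (drain (w + s) t)| ≤ C * (s * u + u ^ 2 / 2) := by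
  have hDc := hC.continuous
  have hdiff : D w * u - ∫ t in (0 : ℝ)..u, D (drain (w + s) t)
      = ∫ t in (0 : ℝ)..u, (D w - D (drain (w + s) t)) := by
    rw [intervalIntegral.integral_sub (by simp) (Continuous.intervalIntegrable (by fun_prop) _ _)]
    simp [mul_comm]
  have hpoint : ∀ t ∈ Set.Ioc 0 u, ‖D w - D (drain (w + s) t)‖ ≤ C * (s + t) := fun t ht => by
    refine (hC.dist_le_mul _ _).trans (mul_le_mul_of_nonneg_left ?_ C.coe_nonneg)
    rw [Real.dist_eq, drain, abs_le]
    rcases max_cases (w + s - t) 0 with h | h <;> constructor <;> linarith [ht.1]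
  rw [hdiff]
  refine (intervalIntegral.norm_integral_le_of_norm_le hu (ae_of_all _ hpoint)
    (Continuous.intervalIntegrable (by fun_prop) _ _)).trans_eq ?_
  rw [intervalIntegral.integral_const_mul, intervalIntegral.integral_add (by simp) (by simp)]
  simp [mul_comm]

/-- A test function `F` for the workload process, with its first two derivatives `G` and `D`. The
condition `G 0 = 0` is the boundary condition of reflection at `0`. -/
structure IsTestFunction (F G D : ℝ → ℝ) (L C : ℝ≥0) (K : ℝ) : Prop where
  hasDerivAt : ∀ x, HasDerivAt F (G x) x
  hasDerivAt_deriv : ∀ x, HasDerivAt G (D x) x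
  map_zero : F 0 = 0
  deriv_zero : G 0 = 0
  lipschitzWith_deriv : LipschitzWith L G
  lipschitzWith_deriv_two : LipschitzWith C D
  abs_deriv_le : ∀ x, |G x| ≤ K
  abs_deriv_two_le : ∀ x, |D x| ≤ K

/-- The generator `κ F'' - (1 - ρ) F'` of the reflected Brownian motion that approximates the
workload, applied to a function with first two derivatives `G` and `D`. -/
def diffusionGenerator (ρ κ : ℝ) (G D : ℝ → ℝ) (x : ℝ) : ℝ := κ * D x - (1 - ρ) * G x

/-- The first and second order terms of the increment of a test function over a cycle that starts
from the workload `w`, centred so as to have mean zero. -/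
def centredIncrement (ρ κ : ℝ) (G D : ℝ → ℝ) (w u s : ℝ) : ℝ :=
  G w * (s - ρ * u) + D w * ((s - ρ * u) ^ 2 / 2 - κ * u)

/-- The part of the error of the diffusion approximation over one cycle that depends only on the
interarrival time `u` and the service time `s` of the cycle. -/
def cycleBound (ρ κ : ℝ) (L C : ℝ≥0) (u s : ℝ) : ℝ :=
  (1 - ρ) * (ρ * L * (u ^ 2 / 2)) + C * |s - ρ * u| ^ 3 + κ * (C * (s * u + u ^ 2 / 2))

namespace IsTestFunction

lemma continuous (h : IsTestFunction F G D L C K) : Continuous F :=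
  continuous_iff_continuousAt.2 fun x => (h.hasDerivAt x).continuousAt

lemma continuous_diffusionGenerator (h : IsTestFunction F G D L C K) (ρ κ : ℝ) :
    Continuous (diffusionGenerator ρ κ G D) :=
  (h.lipschitzWith_deriv_two.continuous.const_mul κ).sub
    (h.lipschitzWith_deriv.continuous.const_mul (1 - ρ))

lemma abs_diffusionGenerator_le (h : IsTestFunction F G D L C K) (ρ κ x : ℝ) :
    |diffusionGenerator ρ κ G D x| ≤ |κ| * K + |1 - ρ| * K := by
  refine (abs_sub _ _).trans ?_
  rw [abs_mul, abs_mul]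
  gcongr
  exacts [h.abs_deriv_two_le x, h.abs_deriv_le x]

lemma abs_le (h : IsTestFunction F G D L C K) (x : ℝ) : |F x| ≤ K * |x| := by
  simpa [h.map_zero] using Convex.norm_image_sub_le_of_norm_hasDerivWithin_le (s := Set.univ)
    (x := 0) (y := x) (fun y _ => (h.hasDerivAt y).hasDerivWithinAt)
    (fun y _ => h.abs_deriv_le y) convex_univ (Set.mem_univ _) (Set.mem_univ _)

/- The path jumps from `w` to `w + s` and drains for the time `u`. The net increment is compared
with that of `F` at `w + (s - ρ u)`, where the service work exceeds its expected share `ρ u`. -/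
lemma abs_cycle_increment_le (h : IsTestFunction F G D L C K) (hρ0 : 0 ≤ ρ) (hρ1 : ρ ≤ 1)
    (hκ : 0 ≤ κ) {w s u : ℝ} (hw : 0 ≤ w) (hs : 0 ≤ s) (hu : 0 ≤ u) :
    |F (drain (w + s) u) - F w - (∫ t in (0 : ℝ)..u, diffusionGenerator ρ κ G D (drain (w + s) t))
        - centredIncrement ρ κ G D w u s|
      ≤ cycleBound ρ κ L C u s + ρ * L / 2 * max (u - (w + s)) 0 ^ 2 := by
  have hG := h.lipschitzWith_deriv.continuous
  have hD := h.lipschitzWith_deriv_two.continuous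
  have hsplit : ∫ t in (0 : ℝ)..u, diffusionGenerator ρ κ G D (drain (w + s) t)
      = κ * (∫ t in (0 : ℝ)..u, D (drain (w + s) t))
        - (1 - ρ) * ∫ t in (0 : ℝ)..u, G (drain (w + s) t) := by
    simp only [diffusionGenerator]
    rw [intervalIntegral.integral_sub (Continuous.intervalIntegrable (by fun_prop) _ _)
      (Continuous.intervalIntegrable (by fun_prop) _ _), intervalIntegral.integral_const_mul,
      intervalIntegral.integral_const_mul]
  have hdrain := abs_sub_add_integral_drain_le h.hasDerivAt h.lipschitzWith_deriv h.deriv_zero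
    hρ0 hρ1 (w + s) hu
  have hidle := abs_comp_max_sub_comp_le h.hasDerivAt h.lipschitzWith_deriv h.deriv_zero hρ0 hρ1
    (add_nonneg hw hs) u
  have htaylor := abs_taylor_two_le h.hasDerivAt h.hasDerivAt_deriv h.lipschitzWith_deriv_two w
    (s - ρ * u)
  rw [← add_sub_assoc] at htaylor
  have hdiffusion : |κ * (D w * u - ∫ t in (0 : ℝ)..u, D (drain (w + s) t))|
      ≤ κ * (C * (s * u + u ^ 2 / 2)) := by
    rw [abs_mul, abs_of_nonneg hκ]
    exact mul_le_mul_of_nonneg_left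
      (abs_mul_sub_integral_drain_le h.lipschitzWith_deriv_two hw hs hu) hκ
  have hcube : 0 ≤ C * |s - ρ * u| ^ 3 := by positivity
  rw [hsplit, cycleBound, centredIncrement]
  rw [_root_.abs_le] at hdrain hidle htaylor hdiffusion ⊢
  constructor <;> linarith [hdrain.1, hdrain.2, hidle.1, hidle.2, htaylor.1, htaylor.2,
    hdiffusion.1, hdiffusion.2]

end IsTestFunction

end Deterministic

section TimeAverage

open scoped BoundedContinuousFunction

/-- The integral of `φ (V(t))` over the `k`-th interarrival time. -/
def cycleIntegral (U S : ℕ → Ω → ℝ) (φ : ℝ → ℝ) (k : ℕ) (ω : Ω) : ℝ :=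
  ∫ s in (0 : ℝ)..U k ω, φ (drain (workloadBefore U S k ω + S k ω) s)

variable {U S : ℕ → Ω → ℝ} {ω : Ω}

lemma ae_comp_workload_eq (hU : ∀ n, 0 ≤ U n ω) (φ : ℝ → ℝ) (k : ℕ) :
    ∀ᵐ t, t ∈ Set.uIoc (arrivalTime U k ω) (arrivalTime U (k + 1) ω) →
      φ (drain (workloadBefore U S k ω + S k ω) (t - arrivalTime U k ω))
        = φ (workload U S t ω) := by
  filter_upwards [compl_mem_ae_iff.2 (measure_singleton (arrivalTime U (k + 1) ω))] with t hne ht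
  rw [Set.uIoc_of_le (arrivalTime_monotone hU k.le_succ)] at ht
  rw [workload_eq hU ht.1.le (lt_of_le_of_ne ht.2 hne), drain]

lemma integral_workload_eq_sum_cycleIntegral (hU : ∀ n, 0 ≤ U n ω) {φ : ℝ → ℝ}
    (hφ : Continuous φ) (n : ℕ) :
    ∫ t in (0 : ℝ)..arrivalTime U n ω, φ (workload U S t ω)
      = ∑ k ∈ Finset.range n, cycleIntegral U S φ k ω := by
  have hint : ∀ k < n, IntervalIntegrable (fun t => φ (workload U S t ω)) volume
      (arrivalTime U k ω) (arrivalTime U (k + 1) ω) := fun k _ =>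
    (Continuous.intervalIntegrable (by fun_prop) _ _).congr_ae
      ((ae_restrict_iff' measurableSet_uIoc).2 (ae_comp_workload_eq hU φ k))
  have hcycle : ∀ k, ∫ t in arrivalTime U k ω..arrivalTime U (k + 1) ω, φ (workload U S t ω)
      = cycleIntegral U S φ k ω := fun k => by
    rw [← intervalIntegral.integral_congr_ae (ae_comp_workload_eq hU φ k),
      intervalIntegral.integral_comp_sub_right
        (fun s => φ (drain (workloadBefore U S k ω + S k ω) s)), sub_self, arrivalTime_succ,
      add_sub_cancel_left, cycleIntegral]
  have hsum := intervalIntegral.sum_integral_adjacent_intervals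
    (a := fun k => arrivalTime U k ω) hint
  simp only [hcycle] at hsum
  rw [hsum]
  simp only [arrivalTime, Finset.range_zero, Finset.sum_empty]

lemma iSup_ite_eq_sSup (p : ℕ → Prop) [DecidablePred p] :
    ⨆ n, (if p n then n else 0) = sSup {n | p n} := by
  by_cases hbdd : BddAbove {n | p n}
  · have hle : ∀ n, (if p n then n else 0) ≤ sSup {n | p n} := fun n => by
      split_ifs with hn
      exacts [le_csSup hbdd hn, Nat.zero_le _]
    have hrange : BddAbove (Set.range fun n => if p n then n else 0) :=
      ⟨_, Set.forall_mem_range.2 hle⟩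
    refine le_antisymm (ciSup_le hle) (csSup_le' fun n hn => ?_)
    exact le_ciSup_of_le hrange n (if_pos hn).ge
  · have hunbdd : ¬ BddAbove (Set.range fun n => if p n then n else 0) := fun hrange =>
      hbdd (hrange.mono fun n (hn : p n) => Set.mem_range.2 ⟨n, if_pos hn⟩)
    rw [iSup, Nat.sSup_of_not_bddAbove hbdd, Nat.sSup_of_not_bddAbove hunbdd]

namespace IsInput

variable [MeasurableSpace Ω] {P : Measure Ω}

lemma measurable_arrivalTime (h : IsInput P U S) (n : ℕ) : Measurable (arrivalTime U n) :=
  Finset.measurable_sum _ fun k _ => h.measurable_interarrival k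

lemma measurable_lastArrival (h : IsInput P U S) :
    Measurable fun p : ℝ × Ω => lastArrival U p.1 p.2 := by
  classical
  have hset : ∀ n, MeasurableSet {p : ℝ × Ω | arrivalTime U n p.2 ≤ p.1} := fun n =>
    measurableSet_le ((h.measurable_arrivalTime n).comp measurable_snd) measurable_fst
  simp only [lastArrival, ← iSup_ite_eq_sSup]
  exact Measurable.iSup fun n => Measurable.ite (hset n) measurable_const measurable_const

lemma measurable_workload (h : IsInput P U S) :
    Measurable fun p : ℝ × Ω => workload U S p.1 p.2 := by
  have hcustomer : Measurable fun q : (ℝ × Ω) × ℕ =>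
      max (workloadBefore U S q.2 q.1.2 + S q.2 q.1.2 - (q.1.1 - arrivalTime U q.2 q.1.2)) 0 := by
    refine measurable_from_prod_countable_left fun n => ?_
    have hdepart : Measurable fun ω => workloadBefore U S n ω + S n ω + arrivalTime U n ω :=
      ((h.measurable_workloadBefore n).add (h.measurable_service n)).add
        (h.measurable_arrivalTime n)
    have hbusy := ((hdepart.comp measurable_snd).sub measurable_fst).max
      (measurable_const (a := (0 : ℝ)))
    simpa only [sub_sub_eq_add_sub, Pi.sub_apply, Function.comp_apply] using hbusy
  exact hcustomer.comp (measurable_id.prodMk h.measurable_lastArrival)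

lemma integrable_arrivalTime (h : IsInput P U S) (hU : Integrable (U 0) P) (n : ℕ) :
    Integrable (arrivalTime U n) P :=
  integrable_finsetSum _ fun k _ => (h.identDistrib_interarrival k).integrable_iff.2 hU

lemma integrable_cycleIntegral (h : IsInput P U S) (hU : Integrable (U 0) P) (φ : ℝ →ᵇ ℝ)
    (k : ℕ) : Integrable (cycleIntegral U S φ k) P := by
  have hW := h.measurable_workloadBefore k
  have hS := h.measurable_service k
  have hUm := h.measurable_interarrival k
  have hrescale : cycleIntegral U S φ k = fun ω =>
      U k ω * ∫ s in (0 : ℝ)..1, φ (drain (workloadBefore U S k ω + S k ω) (U k ω * s)) := by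
    funext ω
    rw [intervalIntegral.mul_integral_comp_mul_left
      (f := fun s => φ (drain (workloadBefore U S k ω + S k ω) s)), mul_zero, mul_one,
      cycleIntegral]
  have hmeas : Measurable (cycleIntegral U S φ k) := by
    simp only [hrescale, intervalIntegral.integral_of_le zero_le_one]
    refine hUm.mul (StronglyMeasurable.integral_prod_right (f := fun (ω : Ω) (s : ℝ) =>
      φ (drain (workloadBefore U S k ω + S k ω) (U k ω * s))) ?_).measurable
    refine (φ.continuous.measurable.comp ?_).stronglyMeasurable
    simp only [drain]
    fun_prop
  refine (((h.identDistrib_interarrival k).integrable_iff.2 hU).const_mul ‖φ‖).mono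
    hmeas.aestronglyMeasurable (ae_of_all _ fun ω => ?_)
  have hbound := intervalIntegral.norm_integral_le_of_norm_le_const (a := (0 : ℝ)) (b := U k ω)
    (f := fun s => φ (drain (workloadBefore U S k ω + S k ω) s)) (C := ‖φ‖)
    fun s _ => φ.norm_coe_le_norm _
  rwa [sub_zero, ← abs_of_nonneg (norm_nonneg φ), ← abs_mul] at hbound

lemma tendsto_integral_abs_arrivalTime_sub (h : IsInput P U S) (hU : Integrable (U 0) P) :
    Tendsto (fun n : ℕ => (n : ℝ)⁻¹ * ∫ ω, |arrivalTime U n ω - n * ∫ ω, U 0 ω ∂P| ∂P) atTop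
      (𝓝 0) := by
  have hlaw := (ENNReal.tendsto_toReal ENNReal.zero_ne_top).comp <|
    strong_law_Lp (p := 1) le_rfl ENNReal.one_ne_top U (memLp_one_iff_integrable.2 hU)
      (fun i j hij => h.indep.indepFun (i := Sum.inl i) (j := Sum.inl j) (by simpa using hij))
      h.identDistrib_interarrival
  rw [ENNReal.toReal_zero] at hlaw
  refine hlaw.congr' ?_
  filter_upwards [eventually_gt_atTop 0] with n hn
  have hn' : (0 : ℝ) < n := by exact_mod_cast hn
  have hmeas : AEStronglyMeasurable
      (fun ω => (n : ℝ)⁻¹ • (∑ i ∈ Finset.range n, U i ω) - ∫ ω, U 0 ω ∂P) P :=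
    ((h.integrable_arrivalTime hU n).1.const_smul ((n : ℝ)⁻¹)).sub aestronglyMeasurable_const
  rw [Function.comp_apply, eLpNorm_one_eq_lintegral_enorm, ← integral_norm_eq_lintegral_enorm hmeas,
    ← integral_const_mul]
  refine integral_congr_ae (ae_of_all _ fun ω => ?_)
  simp only [smul_eq_mul, Real.norm_eq_abs, arrivalTime]
  rw [← abs_of_pos (inv_pos.2 hn'), ← abs_mul, mul_sub, inv_mul_cancel_left₀ hn'.ne',
    abs_of_pos (inv_pos.2 hn')]

variable [IsProbabilityMeasure P]

lemma integrable_comp_workload_prod (h : IsInput P U S) (φ : ℝ →ᵇ ℝ) (T : ℝ) :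
    Integrable (fun p : ℝ × Ω => φ (workload U S p.1 p.2))
      ((volume.restrict (Set.Ioc 0 T)).prod P) :=
  .of_bound (φ.continuous.measurable.comp h.measurable_workload).aestronglyMeasurable ‖φ‖
    (ae_of_all _ fun _ => φ.norm_coe_le_norm _)

lemma abs_sum_integral_cycleIntegral_sub_le (h : IsInput P U S) (hU : Integrable (U 0) P)
    (φ : ℝ →ᵇ ℝ) (n : ℕ) {T : ℝ} (hT : 0 ≤ T) :
    |(∑ k ∈ Finset.range n, ∫ ω, cycleIntegral U S φ k ω ∂P)
        - ∫ t in (0 : ℝ)..T, ∫ ω, φ (workload U S t ω) ∂P|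
      ≤ ‖φ‖ * ∫ ω, |arrivalTime U n ω - T| ∂P := by
  have hprod := h.integrable_comp_workload_prod φ T
  have hswap : ∫ t in (0 : ℝ)..T, ∫ ω, φ (workload U S t ω) ∂P
      = ∫ ω, (∫ t in (0 : ℝ)..T, φ (workload U S t ω)) ∂P := by
    simp only [intervalIntegral.integral_of_le hT]
    exact integral_integral_swap hprod
  have hint : Integrable (fun ω => ∫ t in (0 : ℝ)..T, φ (workload U S t ω)) P := by
    simp only [intervalIntegral.integral_of_le hT]
    exact hprod.integral_prod_right
  have hcycle := fun k (_ : k ∈ Finset.range n) => h.integrable_cycleIntegral hU φ k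
  rw [hswap, ← integral_finsetSum _ hcycle, ← integral_sub (integrable_finsetSum _ hcycle) hint,
    ← integral_const_mul]
  have hpath : ∀ ω a b, IntervalIntegrable (fun t => φ (workload U S t ω)) volume a b :=
    fun ω a b => (intervalIntegrable_const : IntervalIntegrable (fun _ => ‖φ‖) volume a b).mono_fun
      (φ.continuous.measurable.comp
        (h.measurable_workload.comp measurable_prodMk_right)).aestronglyMeasurable
      (ae_of_all _ fun t => (φ.norm_coe_le_norm _).trans (le_abs_self _))
  have hbound : ∀ᵐ ω ∂P, ‖(∑ k ∈ Finset.range n, cycleIntegral U S φ k ω)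
      - ∫ t in (0 : ℝ)..T, φ (workload U S t ω)‖ ≤ ‖φ‖ * |arrivalTime U n ω - T| := by
    filter_upwards [ae_all_iff.2 h.nonneg_interarrival] with ω hω
    rw [← integral_workload_eq_sum_cycleIntegral hω φ.continuous,
      intervalIntegral.integral_interval_sub_left (hpath _ _ _) (hpath _ _ _)]
    exact intervalIntegral.norm_integral_le_of_norm_le_const fun t _ => φ.norm_coe_le_norm _
  exact norm_integral_le_of_norm_le
    (((h.integrable_arrivalTime hU n).sub (integrable_const T)).abs.const_mul ‖φ‖) hbound

lemma tendsto_sum_integral_cycleIntegral (h : IsInput P U S) (hU : Integrable (U 0) P)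
    (hU0 : 0 < ∫ ω, U 0 ω ∂P) (φ : ℝ →ᵇ ℝ) {ℓ : ℝ}
    (hlim : Tendsto (fun T : ℝ => T⁻¹ * ∫ t in (0 : ℝ)..T, ∫ ω, φ (workload U S t ω) ∂P)
      atTop (𝓝 ℓ)) :
    Tendsto (fun n : ℕ => (n : ℝ)⁻¹ * ∑ k ∈ Finset.range n, ∫ ω, cycleIntegral U S φ k ω ∂P)
      atTop (𝓝 ((∫ ω, U 0 ω ∂P) * ℓ)) := by
  set μ := ∫ ω, U 0 ω ∂P
  set I : ℝ → ℝ := fun T => ∫ t in (0 : ℝ)..T, ∫ ω, φ (workload U S t ω) ∂P with hI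
  have haverage : Tendsto (fun n : ℕ => (n : ℝ)⁻¹ * I (n * μ)) atTop (𝓝 (μ * ℓ)) := by
    refine ((hlim.comp (tendsto_natCast_atTop_atTop.atTop_mul_const hU0)).const_mul μ).congr
      fun n => ?_
    simp only [Function.comp_apply, mul_inv, hI]
    field_simp
  have hzero : Tendsto (fun n : ℕ => (n : ℝ)⁻¹ *
      ((∑ k ∈ Finset.range n, ∫ ω, cycleIntegral U S φ k ω ∂P) - I (n * μ))) atTop (𝓝 0) := by
    have hlaw := (h.tendsto_integral_abs_arrivalTime_sub hU).const_mul ‖φ‖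
    rw [mul_zero] at hlaw
    refine squeeze_zero_norm (fun n => ?_) hlaw
    rw [norm_mul, Real.norm_of_nonneg (by positivity), mul_left_comm ‖φ‖]
    exact mul_le_mul_of_nonneg_left
      (h.abs_sum_integral_cycleIntegral_sub_le hU φ n (by positivity)) (by positivity)
  simpa only [mul_sub, add_sub_cancel, add_zero] using haverage.add hzero

end IsInput

end TimeAverage

section Generator

open scoped NNReal BoundedContinuousFunction

variable {F G D : ℝ → ℝ} {L C : ℝ≥0} {K ρ κ : ℝ}

/-- The image of a test function under the generator of the approximating diffusion, as a bounded
continuous function, the class of functions in which the convergence of the workload is stated. -/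
def IsTestFunction.generator (hF : IsTestFunction F G D L C K) (ρ κ : ℝ) : ℝ →ᵇ ℝ :=
  .ofNormedAddCommGroup (diffusionGenerator ρ κ G D) (hF.continuous_diffusionGenerator ρ κ) _
    (hF.abs_diffusionGenerator_le ρ κ)

namespace IsInput

variable [MeasurableSpace Ω] {P : Measure Ω} {U S : ℕ → Ω → ℝ}

lemma indepFun_service_interarrival (h : IsInput P U S) (j k : ℕ) : IndepFun (S j) (U k) P :=
  h.indep.indepFun (i := Sum.inr j) (j := Sum.inl k) Sum.inr_ne_inl

lemma integral_comp_workloadBefore_mul_eq_zero (h : IsInput P U S) {f : ℝ → ℝ}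
    (hf : Measurable f) {φ : ℝ × ℝ → ℝ} (hφ : Measurable φ)
    (hφ0 : ∫ ω, φ (U 0 ω, S 0 ω) ∂P = 0) (k : ℕ) :
    ∫ ω, f (workloadBefore U S k ω) * φ (U k ω, S k ω) ∂P = 0 :=
  (h.integral_past_mul (hf.comp (measurable_past_workloadBefore k)) hφ).trans
    (mul_eq_zero_of_right _ hφ0)

lemma integrable_workloadBefore (h : IsInput P U S) (hU : Integrable (U 0) P)
    (hS : Integrable (S 0) P) (k : ℕ) : Integrable (workloadBefore U S k) P := by
  rw [← memLp_one_iff_integrable] at hU hS ⊢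
  exact h.memLp_workloadBefore hU hS k

lemma integrable_comp_workloadBefore (h : IsInput P U S) (hF : IsTestFunction F G D L C K)
    (hU : Integrable (U 0) P) (hS : Integrable (S 0) P) (k : ℕ) :
    Integrable (fun ω => F (workloadBefore U S k ω)) P :=
  ((h.integrable_workloadBefore hU hS k).abs.const_mul K).mono'
    (hF.continuous.measurable.comp (h.measurable_workloadBefore k)).aestronglyMeasurable
    (ae_of_all _ fun _ => hF.abs_le _)

variable [IsProbabilityMeasure P]

lemma integrable_comp_workloadBefore_mul (h : IsInput P U S) {f : ℝ → ℝ} (hf : Continuous f)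
    (hK : ∀ x, |f x| ≤ K) {φ : ℝ × ℝ → ℝ} (hφ : Measurable φ)
    (hφi : Integrable (fun ω => φ (U 0 ω, S 0 ω)) P) (k : ℕ) :
    Integrable (fun ω => f (workloadBefore U S k ω) * φ (U k ω, S k ω)) P :=
  h.integrable_past_mul (hf.measurable.comp (measurable_past_workloadBefore k))
    (.of_bound (hf.measurable.comp (h.measurable_workloadBefore k)).aestronglyMeasurable K
      (ae_of_all _ fun _ => hK _)) hφ hφi

lemma integrable_cycleBound (h : IsInput P U S) (hU : MemLp (U 0) 3 P) (hS : MemLp (S 0) 3 P)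
    (ρ κ : ℝ) (L C : ℝ≥0) : Integrable (fun ω => cycleBound ρ κ L C (U 0 ω) (S 0 ω)) P := by
  have hU2 := (hU.mono_exponent (q := 3) (p := 2) (by norm_num)).integrable_sq.div_const 2
  have hSU := (h.indepFun_service_interarrival 0 0).integrable_mul
    (hS.integrable (by norm_num)) (hU.integrable (by norm_num))
  have hcube := (hS.sub (hU.const_mul ρ)).integrable_norm_pow (p := 3) (by norm_num)
  exact (((hU2.const_mul _).const_mul _).add (hcube.const_mul _)).add
    (((hSU.add hU2).const_mul _).const_mul _)

lemma integral_cycleBound (h : IsInput P U S) (hU : MemLp (U 0) 3 P) (hS : MemLp (S 0) 3 P)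
    (ρ κ : ℝ) (L C : ℝ≥0) :
    ∫ ω, cycleBound ρ κ L C (U 0 ω) (S 0 ω) ∂P
      = (1 - ρ) * (ρ * L * ((∫ ω, U 0 ω ^ 2 ∂P) / 2)) + C * ∫ ω, |S 0 ω - ρ * U 0 ω| ^ 3 ∂P
        + κ * (C * ((∫ ω, S 0 ω ∂P) * (∫ ω, U 0 ω ∂P) + (∫ ω, U 0 ω ^ 2 ∂P) / 2)) := by
  have hU1 := hU.integrable (by norm_num)
  have hS1 := hS.integrable (by norm_num)
  have hU2 := (hU.mono_exponent (q := 3) (p := 2) (by norm_num)).integrable_sq.div_const 2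
  have hSU : Integrable (fun ω => S 0 ω * U 0 ω) P :=
    (h.indepFun_service_interarrival 0 0).integrable_mul hS1 hU1
  have hcube : Integrable (fun ω => |S 0 ω - ρ * U 0 ω| ^ 3) P :=
    (hS.sub (hU.const_mul ρ)).integrable_norm_pow (p := 3) (by norm_num)
  have hproduct : ∫ ω, S 0 ω * U 0 ω ∂P = (∫ ω, S 0 ω ∂P) * ∫ ω, U 0 ω ∂P :=
    (h.indepFun_service_interarrival 0 0).integral_fun_mul_eq_mul_integral
      hS1.aestronglyMeasurable hU1.aestronglyMeasurable
  simp only [cycleBound]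
  rw [integral_add (((hU2.const_mul _).const_mul _).fun_add (hcube.const_mul _))
      (((hSU.fun_add hU2).const_mul _).const_mul _),
    integral_add ((hU2.const_mul _).const_mul _) (hcube.const_mul _), integral_const_mul,
    integral_const_mul, integral_const_mul, integral_const_mul, integral_const_mul,
    integral_add hSU hU2, integral_div, hproduct]

lemma integrable_increment_terms (h : IsInput P U S) (hU : MemLp (U 0) 2 P) (hS : MemLp (S 0) 2 P)
    (hF : IsTestFunction F G D L C K) (ρ κ : ℝ) (k : ℕ) :
    Integrable (fun ω => G (workloadBefore U S k ω) * (S k ω - ρ * U k ω)) P ∧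
      Integrable (fun ω => D (workloadBefore U S k ω)
        * ((S k ω - ρ * U k ω) ^ 2 / 2 - κ * U k ω)) P := by
  have hU1 := hU.integrable one_le_two
  exact ⟨h.integrable_comp_workloadBefore_mul hF.lipschitzWith_deriv.continuous
    hF.abs_deriv_le (φ := fun p => p.2 - ρ * p.1) (by fun_prop)
    ((hS.integrable one_le_two).sub (hU1.const_mul ρ)) k,
    h.integrable_comp_workloadBefore_mul hF.lipschitzWith_deriv_two.continuous
    hF.abs_deriv_two_le (φ := fun p => (p.2 - ρ * p.1) ^ 2 / 2 - κ * p.1) (by fun_prop)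
    (((hS.sub (hU.const_mul ρ)).integrable_sq.div_const 2).sub (hU1.const_mul κ)) k⟩

lemma integral_centredIncrement (h : IsInput P U S) (hU : MemLp (U 0) 2 P)
    (hS : MemLp (S 0) 2 P) (hF : IsTestFunction F G D L C K)
    (hρ : ∫ ω, (S 0 ω - ρ * U 0 ω) ∂P = 0)
    (hκ : ∫ ω, ((S 0 ω - ρ * U 0 ω) ^ 2 / 2 - κ * U 0 ω) ∂P = 0) (k : ℕ) :
    ∫ ω, centredIncrement ρ κ G D (workloadBefore U S k ω) (U k ω) (S k ω) ∂P = 0 := by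
  obtain ⟨hG, hD⟩ := h.integrable_increment_terms hU hS hF ρ κ k
  simp only [centredIncrement]
  rw [integral_add hG hD,
    h.integral_comp_workloadBefore_mul_eq_zero hF.lipschitzWith_deriv.continuous.measurable
      (φ := fun p => p.2 - ρ * p.1) (by fun_prop) hρ k,
    h.integral_comp_workloadBefore_mul_eq_zero hF.lipschitzWith_deriv_two.continuous.measurable
      (φ := fun p => (p.2 - ρ * p.1) ^ 2 / 2 - κ * p.1) (by fun_prop) hκ k, add_zero]

lemma abs_integral_increment_sub_le (h : IsInput P U S) (hU : MemLp (U 0) 3 P)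
    (hS : MemLp (S 0) 3 P) (hF : IsTestFunction F G D L C K) (hρ0 : 0 ≤ ρ) (hρ1 : ρ ≤ 1)
    (hκ0 : 0 ≤ κ) (hρ : ∫ ω, (S 0 ω - ρ * U 0 ω) ∂P = 0)
    (hκ : ∫ ω, ((S 0 ω - ρ * U 0 ω) ^ 2 / 2 - κ * U 0 ω) ∂P = 0) (k : ℕ) :
    |∫ ω, F (workloadBefore U S (k + 1) ω) ∂P - ∫ ω, F (workloadBefore U S k ω) ∂P
        - ∫ ω, cycleIntegral U S (hF.generator ρ κ) k ω ∂P|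
      ≤ ∫ ω, cycleBound ρ κ L C (U 0 ω) (S 0 ω) ∂P
        + ρ * L / 2 * ∫ ω, idleTime U S k ω ^ 2 ∂P := by
  have hU1 := hU.integrable (by norm_num)
  have hS1 := hS.integrable (by norm_num)
  have hU2 : MemLp (U 0) 2 P := hU.mono_exponent (by norm_num)
  have hS2 : MemLp (S 0) 2 P := hS.mono_exponent (by norm_num)
  have hW := fun k => h.integrable_comp_workloadBefore hF hU1 hS1 k
  have hcycle := h.integrable_cycleIntegral hU1 (hF.generator ρ κ) k
  obtain ⟨hG, hD⟩ := h.integrable_increment_terms hU2 hS2 hF ρ κ k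
  have hcentred : Integrable (fun ω =>
      centredIncrement ρ κ G D (workloadBefore U S k ω) (U k ω) (S k ω)) P := hG.add hD
  have hstep : Integrable (fun ω => F (workloadBefore U S (k + 1) ω)
      - F (workloadBefore U S k ω)) P := (hW (k + 1)).sub (hW k)
  have hrest : Integrable (fun ω => F (workloadBefore U S (k + 1) ω) - F (workloadBefore U S k ω)
      - cycleIntegral U S (hF.generator ρ κ) k ω) P := hstep.sub hcycle
  have hmean : ∫ ω, (F (workloadBefore U S (k + 1) ω) - F (workloadBefore U S k ω)
        - cycleIntegral U S (hF.generator ρ κ) k ω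
        - centredIncrement ρ κ G D (workloadBefore U S k ω) (U k ω) (S k ω)) ∂P
      = ∫ ω, F (workloadBefore U S (k + 1) ω) ∂P - ∫ ω, F (workloadBefore U S k ω) ∂P
        - ∫ ω, cycleIntegral U S (hF.generator ρ κ) k ω ∂P := by
    rw [integral_sub hrest hcentred, integral_sub hstep hcycle,
      integral_sub (hW (k + 1)) (hW k), h.integral_centredIncrement hU2 hS2 hF hρ hκ, sub_zero]
  have hident := (h.identDistrib_pair k).comp (u := fun p => cycleBound ρ κ L C p.1 p.2)
    (by unfold cycleBound; fun_prop)
  have hBi : Integrable (fun ω => cycleBound ρ κ L C (U k ω) (S k ω)) P :=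
    hident.integrable_iff.2 (h.integrable_cycleBound hU hS ρ κ L C)
  have hBeq : ∫ ω, cycleBound ρ κ L C (U k ω) (S k ω) ∂P
      = ∫ ω, cycleBound ρ κ L C (U 0 ω) (S 0 ω) ∂P := hident.integral_eq
  have hI := (h.memLp_idleTime hU2 hS2 k).integrable_sq.const_mul (ρ * L / 2)
  rw [← hmean, ← integral_const_mul, ← hBeq, ← integral_add hBi hI, ← Real.norm_eq_abs]
  refine norm_integral_le_of_norm_le (hBi.fun_add hI) ?_
  filter_upwards [h.nonneg_interarrival k, h.nonneg_service k] with ω hu hs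
  have hpath := hF.abs_cycle_increment_le hρ0 hρ1 hκ0 (workloadBefore_nonneg U S k ω) hs hu
  rwa [← neg_sub (_ + _)] at hpath

lemma abs_sum_integral_cycleIntegral_le (h : IsInput P U S) (hU : MemLp (U 0) 3 P)
    (hS : MemLp (S 0) 3 P) (hF : IsTestFunction F G D L C K) (hρ0 : 0 ≤ ρ) (hρ1 : ρ ≤ 1)
    (hκ0 : 0 ≤ κ) (hρ : ∫ ω, (S 0 ω - ρ * U 0 ω) ∂P = 0)
    (hκ : ∫ ω, ((S 0 ω - ρ * U 0 ω) ^ 2 / 2 - κ * U 0 ω) ∂P = 0) (n : ℕ) :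
    |∑ k ∈ Finset.range n, ∫ ω, cycleIntegral U S (hF.generator ρ κ) k ω ∂P|
      ≤ n * ∫ ω, cycleBound ρ κ L C (U 0 ω) (S 0 ω) ∂P
        + ρ * L / 2 * ∑ k ∈ Finset.range n, ∫ ω, idleTime U S k ω ^ 2 ∂P
        + K * ∫ ω, workloadBefore U S n ω ∂P := by
  have hsum := (Finset.abs_sum_le_sum_abs _ (Finset.range n)).trans (Finset.sum_le_sum fun k _ =>
    h.abs_integral_increment_sub_le hU hS hF hρ0 hρ1 hκ0 hρ hκ k)
  rw [Finset.sum_sub_distrib, Finset.sum_range_sub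
    (fun k => ∫ ω, F (workloadBefore U S k ω) ∂P), Finset.sum_add_distrib, Finset.sum_const,
    Finset.card_range, nsmul_eq_mul, ← Finset.mul_sum] at hsum
  have hstart : ∫ ω, F (workloadBefore U S 0 ω) ∂P = 0 := by
    simp only [workloadBefore, hF.map_zero, integral_zero]
  have hend : |∫ ω, F (workloadBefore U S n ω) ∂P| ≤ K * ∫ ω, workloadBefore U S n ω ∂P := by
    rw [← integral_const_mul, ← Real.norm_eq_abs]
    refine norm_integral_le_of_norm_le (g := fun ω => K * workloadBefore U S n ω)
      ((h.integrable_workloadBefore (hU.integrable (by norm_num))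
        (hS.integrable (by norm_num)) n).const_mul K) (ae_of_all _ fun ω => ?_)
    simpa only [abs_of_nonneg (workloadBefore_nonneg U S n ω), Real.norm_eq_abs] using
      hF.abs_le (workloadBefore U S n ω)
  rw [hstart, sub_zero] at hsum
  rw [abs_le] at hsum hend ⊢
  constructor <;> linarith [hsum.1, hsum.2, hend.1, hend.2]

lemma integral_interarrival_mul_abs_limit_generator_le (h : IsInput P U S) (hU : MemLp (U 0) 3 P)
    (hS : MemLp (S 0) 3 P) (hdrift : ∫ ω, S 0 ω ∂P < ∫ ω, U 0 ω ∂P)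
    (hU0 : 0 < ∫ ω, U 0 ω ∂P) (hF : IsTestFunction F G D L C K) (hρ0 : 0 ≤ ρ) (hρ1 : ρ ≤ 1)
    (hκ0 : 0 ≤ κ) (hρ : ∫ ω, (S 0 ω - ρ * U 0 ω) ∂P = 0)
    (hκ : ∫ ω, ((S 0 ω - ρ * U 0 ω) ^ 2 / 2 - κ * U 0 ω) ∂P = 0) {ℓ : ℝ}
    (hlim : Tendsto (fun T : ℝ =>
      T⁻¹ * ∫ t in (0 : ℝ)..T, ∫ ω, hF.generator ρ κ (workload U S t ω) ∂P) atTop (𝓝 ℓ)) :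
    (∫ ω, U 0 ω ∂P) * |ℓ| ≤ ∫ ω, cycleBound ρ κ L C (U 0 ω) (S 0 ω) ∂P
      + ρ * L / 2 * ((∫ ω, U 0 ω ∂P - ∫ ω, S 0 ω ∂P)
        * ((∫ ω, idlePeriod U S ω ^ 2 ∂P) / ∫ ω, idlePeriod U S ω ∂P)) := by
  have hU2 : MemLp (U 0) 2 P := hU.mono_exponent (by norm_num)
  have hS2 : MemLp (S 0) 2 P := hS.mono_exponent (by norm_num)
  have hcycle := (h.tendsto_sum_integral_cycleIntegral (hU.integrable (by norm_num)) hU0 _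
    hlim).abs
  rw [abs_mul, abs_of_pos hU0] at hcycle
  have hidle := (h.tendsto_sum_integral_sq_idleTime hU2 hS2 hdrift).const_mul (ρ * L / 2)
  have hboundary := (h.tendsto_integral_workloadBefore_div hU2 hS2 hdrift.le).const_mul K
  have hbound := (hidle.const_add (∫ ω, cycleBound ρ κ L C (U 0 ω) (S 0 ω) ∂P)).add hboundary
  rw [mul_zero, add_zero] at hbound
  refine le_of_tendsto_of_tendsto hcycle hbound ?_
  filter_upwards [eventually_gt_atTop 0] with n hn
  have hn' : (0 : ℝ) < n := Nat.cast_pos.2 hn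
  rw [abs_mul, abs_of_pos (inv_pos.2 hn')]
  refine (mul_le_mul_of_nonneg_left
    (h.abs_sum_integral_cycleIntegral_le hU hS hF hρ0 hρ1 hκ0 hρ hκ n) (by positivity)).trans_eq ?_
  field_simp

end IsInput

end Generator

section Positivity

namespace IsInput

variable [MeasurableSpace Ω] {P : Measure Ω} {U S : ℕ → Ω → ℝ}

lemma integral_interarrival_pos (h : IsInput P U S) (hU : Integrable (U 0) P)
    (hnl : Nonlattice P (U 0)) : 0 < ∫ ω, U 0 ω ∂P := by
  refine (integral_nonneg_of_ae (h.nonneg_interarrival 0)).lt_of_ne' fun hzero => ?_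
  have hae := (integral_eq_zero_iff_of_nonneg_ae (h.nonneg_interarrival 0) hU).1 hzero
  exact hnl 1 one_pos (hae.mono fun ω hω => ⟨0, by simpa using hω⟩)

variable [IsProbabilityMeasure P]

/- If `S = ρ U` almost surely, then `U` is independent of a nonzero multiple of itself, hence
constant. -/
lemma integral_sq_sub_pos (h : IsInput P U S) (hU : MemLp (U 0) 2 P) (hS : MemLp (S 0) 2 P)
    (hnl : Nonlattice P (U 0)) (hS0 : ∫ ω, S 0 ω ∂P ≠ 0) (ρ : ℝ) :
    0 < ∫ ω, (S 0 ω - ρ * U 0 ω) ^ 2 ∂P := by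
  refine (integral_nonneg fun ω => sq_nonneg _).lt_of_ne' fun hzero => ?_
  have hae : S 0 =ᵐ[P] fun ω => ρ * U 0 ω := by
    filter_upwards [(integral_eq_zero_iff_of_nonneg (fun ω => sq_nonneg (S 0 ω - ρ * U 0 ω))
      (hS.sub (hU.const_mul ρ)).integrable_sq).1 hzero] with ω hω
    exact sub_eq_zero.1 (pow_eq_zero_iff two_ne_zero |>.1 hω)
  have hρ : ρ ≠ 0 := by
    rintro rfl
    exact hS0 (by simp [integral_congr_ae hae])
  have hvar : Var[U 0; P] = 0 := by
    have hcov := ((h.indepFun_service_interarrival 0 0).congr hae .rfl).covariance_eq_zero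
      (hU.const_mul ρ) hU
    rw [covariance_const_mul_left, covariance_self (h.measurable_interarrival 0).aemeasurable]
      at hcov
    exact (mul_eq_zero.1 hcov).resolve_left hρ
  exact hnl _ (h.integral_interarrival_pos (hU.integrable one_le_two) hnl)
    ((ae_eq_integral_of_variance_eq_zero hU hvar).mono fun ω hω => ⟨1, by simpa using hω⟩)

end IsInput

end Positivity

section SteinTestFunction

open scoped NNReal BoundedContinuousFunction

variable {h : ℝ → ℝ} {r δ M : ℝ}

lemma isTestFunction_steinSolution (hr : 0 < r) (hδ : 0 ≤ δ) (hh : LipschitzWith 1 h)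
    (hM : ∀ x, |h x| ≤ M) :
    IsTestFunction (fun v => ∫ x in (0 : ℝ)..v, steinSolution r h (δ * x))
      (fun v => steinSolution r h (δ * v))
      (fun v => δ * (r * (steinSolution r h (δ * v) + h (δ * v) - ∫ y, h y ∂(expMeasure r))))
      δ.toNNReal (2 * r * δ ^ 2).toNNReal (max (2 * M) (δ * (r * (4 * M)))) := by
  have := isProbabilityMeasure_expMeasure hr
  have hq := lipschitzWith_steinSolution hr hh hM
  have hqc := hq.continuous
  have hscale : ∀ {f : ℝ → ℝ}, LipschitzWith 1 f → ∀ x y,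
      |f (δ * x) - f (δ * y)| ≤ δ * |x - y| := fun hf x y => by
    simpa [Real.dist_eq, ← mul_sub, abs_mul, abs_of_nonneg hδ]
      using hf.dist_le_mul (δ * x) (δ * y)
  refine ⟨fun x => ((show Continuous fun x => steinSolution r h (δ * x) by
      fun_prop).integral_hasStrictDerivAt 0 x).hasDerivAt, fun x => ?_,
    intervalIntegral.integral_same, by simp only [mul_zero, steinSolution_zero],
    .of_dist_le_mul fun x y => ?_, .of_dist_le_mul fun x y => ?_,
    fun x => (abs_steinSolution_le hr hM _).trans (le_max_left _ _),
    fun x => le_max_of_le_right ?_⟩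
  · exact ((hasDerivAt_steinSolution hr hh.continuous hM (δ * x)).comp x
      ((hasDerivAt_id x).const_mul δ)).congr_deriv (by ring)
  · rw [Real.coe_toNNReal _ hδ]
    exact hscale hq x y
  · have hsum := (abs_add_le _ _).trans (add_le_add (hscale hq x y) (hscale hh x y))
    rw [Real.coe_toNNReal _ (by positivity), Real.dist_eq, Real.dist_eq, ← mul_sub, ← mul_sub,
      sub_sub_sub_cancel_right, add_sub_add_comm, abs_mul, abs_mul, abs_of_nonneg hδ,
      abs_of_pos hr]
    exact (mul_le_mul_of_nonneg_left (mul_le_mul_of_nonneg_left hsum hr.le) hδ).trans_eq (by ring)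
  · have hmean : |∫ y, h y ∂(expMeasure r)| ≤ M := by
      simpa using norm_integral_le_of_norm_le_const (μ := expMeasure r) (f := h) (ae_of_all _ hM)
    have hsum := (abs_sub _ _).trans (add_le_add ((abs_add_le _ _).trans
      (add_le_add (abs_steinSolution_le hr hM (δ * x)) (hM (δ * x)))) hmean)
    rw [abs_mul, abs_mul, abs_of_nonneg hδ, abs_of_pos hr]
    exact mul_le_mul_of_nonneg_left (mul_le_mul_of_nonneg_left (hsum.trans_eq (by ring)) hr.le) hδ

lemma diffusionGenerator_steinSolution (hr : r ≠ 0) (ρ : ℝ) (h : ℝ → ℝ) (v : ℝ) :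
    diffusionGenerator ρ r⁻¹ (fun v => steinSolution r h ((1 - ρ) * v))
        (fun v => (1 - ρ) * (r * (steinSolution r h ((1 - ρ) * v) + h ((1 - ρ) * v)
          - ∫ y, h y ∂(expMeasure r)))) v
      = (1 - ρ) * (h ((1 - ρ) * v) - ∫ y, h y ∂(expMeasure r)) := by
  rw [diffusionGenerator]
  field_simp
  ring

end SteinTestFunction

section TimeAverageLimit

open scoped BoundedContinuousFunction

variable [MeasurableSpace Ω] {P : Measure Ω} {U S : ℕ → Ω → ℝ} {Ω' : Type*} [MeasurableSpace Ω']
  {P' : Measure Ω'} {X : Ω' → ℝ}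

/-- The limit of the scaled workload in the sense of time averages: `X` has the limit of the
distributions of the scaled workload at a time that is uniform in `[0, T]`, as `T → ∞`. Such a
limit can exist for lattice interarrival times, when `IsSteadyState` fails. -/
structure IsTimeAverageLimit (P : Measure Ω) (U S : ℕ → Ω → ℝ) (P' : Measure Ω') (X : Ω' → ℝ) :
    Prop where
  aemeasurable : AEMeasurable X P'
  tendsto : ∀ φ : ℝ →ᵇ ℝ, Tendsto
    (fun T : ℝ => T⁻¹ * ∫ t in (0 : ℝ)..T, ∫ ω, φ (scaledWorkload P U S t ω) ∂P) atTop
    (𝓝 (∫ ω, φ (X ω) ∂P'))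

lemma tendsto_inv_mul_integral {e : ℝ → ℝ} {ℓ M : ℝ} (he : Measurable e) (hM : ∀ t, |e t| ≤ M)
    (hℓ : Tendsto e atTop (𝓝 ℓ)) :
    Tendsto (fun T : ℝ => T⁻¹ * ∫ t in (0 : ℝ)..T, e t) atTop (𝓝 ℓ) := by
  have hscaled : Tendsto (fun T : ℝ => ∫ s in (0 : ℝ)..1, e (T * s)) atTop
      (𝓝 (∫ _ in (0 : ℝ)..1, ℓ)) := by
    refine intervalIntegral.tendsto_integral_filter_of_dominated_convergence (fun _ => M)
      (.of_forall fun T => (he.comp (measurable_const_mul T)).aestronglyMeasurable)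
      (.of_forall fun T => ae_of_all _ fun s _ => hM (T * s)) (by simp) (ae_of_all _ fun s hs => ?_)
    rw [Set.uIoc_of_le zero_le_one] at hs
    exact hℓ.comp (tendsto_id.atTop_mul_const hs.1)
  rw [intervalIntegral.integral_const, sub_zero, one_smul] at hscaled
  refine hscaled.congr' ((eventually_gt_atTop 0).mono fun T hT => ?_)
  rw [intervalIntegral.integral_comp_mul_left e hT.ne', mul_zero, mul_one, smul_eq_mul]

variable [IsProbabilityMeasure P] [IsProbabilityMeasure P']

lemma IsSteadyState.isTimeAverageLimit (hX : IsSteadyState P U S P' X) (h : IsInput P U S) :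
    IsTimeAverageLimit P U S P' X := by
  refine ⟨hX.aemeasurable_limit, fun φ => tendsto_inv_mul_integral (M := ‖φ‖) ?_ (fun t => ?_) ?_⟩
  · have hmeas : Measurable fun p : ℝ × Ω => φ (scaledWorkload P U S p.1 p.2) :=
      φ.continuous.measurable.comp (h.measurable_workload.const_mul _)
    exact hmeas.stronglyMeasurable.integral_prod_right.measurable
  · simpa using norm_integral_le_of_norm_le_const (μ := P)
      (ae_of_all _ fun ω => φ.norm_coe_le_norm (scaledWorkload P U S t ω))
  · have hlim := ProbabilityMeasure.tendsto_iff_forall_integral_tendsto.1 hX.tendsto φ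
    simp only [ProbabilityMeasure.coe_mk] at hlim
    rw [integral_map hX.aemeasurable_limit φ.continuous.aestronglyMeasurable] at hlim
    exact hlim.congr fun t =>
      integral_map (hX.forall_aemeasurable t) φ.continuous.aestronglyMeasurable

end TimeAverageLimit

section BoundedTestFunctions

open scoped NNReal BoundedContinuousFunction

/-- The bound of the exponential approximation on the Wasserstein distance between the steady state
of the scaled workload and the exponential distribution. -/
def errorBound [MeasurableSpace Ω] (P : Measure Ω) (U S : ℕ → Ω → ℝ) (ρ : ℝ) : ℝ :=
  (1 - ρ) *
    ((2 + ρ) * ((∫ ω, U 0 ω ^ 2 ∂P) / (2 * ∫ ω, U 0 ω ∂P))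
      + ρ * ((∫ ω, idlePeriod U S ω ^ 2 ∂P) / (2 * ∫ ω, idlePeriod U S ω ∂P))
      + 2 * (∫ ω, S 0 ω ∂P)
      + 4 * ((∫ ω, |S 0 ω - ρ * U 0 ω| ^ 3 ∂P) / ∫ ω, (S 0 ω - ρ * U 0 ω) ^ 2 ∂P))

/-- The rate of the exponential approximation of the scaled workload. -/
def approximationRate [MeasurableSpace Ω] (P : Measure Ω) (U S : ℕ → Ω → ℝ) (ρ : ℝ) : ℝ :=
  2 / (arrivalRate P U * ∫ ω, (S 0 ω - ρ * U 0 ω) ^ 2 ∂P)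

variable [MeasurableSpace Ω] {P : Measure Ω} {U S : ℕ → Ω → ℝ} {Ω' : Type*} [MeasurableSpace Ω']
  {P' : Measure Ω'} {X : Ω' → ℝ} {ρ : ℝ}

lemma approximationRate_pos (hU0 : 0 < ∫ ω, U 0 ω ∂P)
    (hm : 0 < ∫ ω, (S 0 ω - ρ * U 0 ω) ^ 2 ∂P) : 0 < approximationRate P U S ρ := by
  rw [approximationRate, arrivalRate]
  positivity

lemma inv_approximationRate_mul (hU0 : ∫ ω, U 0 ω ∂P ≠ 0) :
    (approximationRate P U S ρ)⁻¹ * ∫ ω, U 0 ω ∂P = (∫ ω, (S 0 ω - ρ * U 0 ω) ^ 2 ∂P) / 2 := by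
  rw [approximationRate, arrivalRate]
  field_simp

lemma utilization_mul_integral (hU0 : ∫ ω, U 0 ω ∂P ≠ 0) :
    utilization P U S * ∫ ω, U 0 ω ∂P = ∫ ω, S 0 ω ∂P := by
  rw [utilization, arrivalRate]
  field_simp

lemma integral_interarrival_sub_service (hU0 : ∫ ω, U 0 ω ∂P ≠ 0) :
    (∫ ω, U 0 ω ∂P) - ∫ ω, S 0 ω ∂P = (1 - utilization P U S) * ∫ ω, U 0 ω ∂P := by
  rw [← utilization_mul_integral (S := S) hU0]
  ring

lemma integral_service_lt (hU0 : 0 < ∫ ω, U 0 ω ∂P) (hρ : utilization P U S < 1) :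
    ∫ ω, S 0 ω ∂P < ∫ ω, U 0 ω ∂P :=
  sub_pos.1 (integral_interarrival_sub_service hU0.ne' ▸ mul_pos (sub_pos.2 hρ) hU0)

lemma IsTimeAverageLimit.tendsto_generator [IsProbabilityMeasure P'] {F : ℝ → ℝ} {h : ℝ → ℝ}
    {M r : ℝ} {L C : ℝ≥0} {K : ℝ}
    (hX : IsTimeAverageLimit P U S P' X) (hr : r ≠ 0) (hh : Continuous h) (hM : ∀ x, |h x| ≤ M)
    (hF : IsTestFunction F (fun v => steinSolution r h ((1 - utilization P U S) * v))
      (fun v => (1 - utilization P U S) * (r * (steinSolution r h ((1 - utilization P U S) * v)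
        + h ((1 - utilization P U S) * v) - ∫ y, h y ∂(expMeasure r)))) L C K) :
    Tendsto (fun T : ℝ => T⁻¹ * ∫ t in (0 : ℝ)..T,
        ∫ ω, hF.generator (utilization P U S) r⁻¹ (workload U S t ω) ∂P) atTop
      (𝓝 ((1 - utilization P U S) * ((∫ ω, h (X ω) ∂P') - ∫ y, h y ∂(expMeasure r)))) := by
  let hb : ℝ →ᵇ ℝ := .ofNormedAddCommGroup h hh M hM
  let φ : ℝ →ᵇ ℝ := (1 - utilization P U S) •
    (hb - BoundedContinuousFunction.const ℝ (∫ y, h y ∂(expMeasure r)))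
  have hφ : ∫ ω, φ (X ω) ∂P'
      = (1 - utilization P U S) * ((∫ ω, h (X ω) ∂P') - ∫ y, h y ∂(expMeasure r)) := by
    have hint : Integrable (fun ω => h (X ω)) P' :=
      .of_bound (hh.measurable.comp_aemeasurable hX.aemeasurable).aestronglyMeasurable M
        (ae_of_all _ fun ω => hM _)
    change ∫ ω, (1 - utilization P U S) * (h (X ω) - ∫ y, h y ∂(expMeasure r)) ∂P' = _
    rw [integral_const_mul, integral_sub hint (integrable_const _), integral_const, probReal_univ,
      one_smul]
  rw [← hφ]
  refine (hX.tendsto φ).congr fun T => ?_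
  congr! 4 with t
  exact funext fun ω => (diffusionGenerator_steinSolution hr _ h (workload U S t ω)).symm

lemma integral_centred_sq [IsFiniteMeasure P] (hU : MemLp (U 0) 2 P) (hS : MemLp (S 0) 2 P)
    (hU0 : ∫ ω, U 0 ω ∂P ≠ 0) (ρ : ℝ) :
    ∫ ω, ((S 0 ω - ρ * U 0 ω) ^ 2 / 2 - (approximationRate P U S ρ)⁻¹ * U 0 ω) ∂P = 0 := by
  have hsq : Integrable (fun ω => (S 0 ω - ρ * U 0 ω) ^ 2) P :=
    (hS.sub (hU.const_mul ρ)).integrable_sq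
  rw [integral_sub (hsq.div_const 2) ((hU.integrable one_le_two).const_mul _), integral_div,
    integral_const_mul, inv_approximationRate_mul hU0, sub_self]

variable [IsProbabilityMeasure P]

lemma IsInput.integral_cycleBound_steinSolution (h : IsInput P U S) (hU : MemLp (U 0) 3 P)
    (hS : MemLp (S 0) 3 P) (hU0 : 0 < ∫ ω, U 0 ω ∂P) (hρ : ρ < 1)
    (hm : 0 < ∫ ω, (S 0 ω - ρ * U 0 ω) ^ 2 ∂P) :
    ∫ ω, cycleBound ρ (approximationRate P U S ρ)⁻¹ (1 - ρ).toNNReal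
          (2 * approximationRate P U S ρ * (1 - ρ) ^ 2).toNNReal (U 0 ω) (S 0 ω) ∂P
        + ρ * (1 - ρ).toNNReal / 2 * ((1 - ρ) * (∫ ω, U 0 ω ∂P)
          * ((∫ ω, idlePeriod U S ω ^ 2 ∂P) / ∫ ω, idlePeriod U S ω ∂P))
      = (∫ ω, U 0 ω ∂P) * ((1 - ρ) * errorBound P U S ρ) := by
  have hr := approximationRate_pos hU0 hm
  rw [h.integral_cycleBound hU hS, Real.coe_toNNReal _ (sub_nonneg.2 hρ.le),
    Real.coe_toNNReal _ (by positivity), errorBound, approximationRate, arrivalRate]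
  field_simp
  ring

lemma IsTimeAverageLimit.abs_integral_sub_le_of_bounded [IsProbabilityMeasure P']
    (hX : IsTimeAverageLimit P U S P' X) (hUS : IsInput P U S) (hU : MemLp (U 0) 3 P)
    (hS : MemLp (S 0) 3 P) (hU0 : 0 < ∫ ω, U 0 ω ∂P) (hρ : utilization P U S < 1)
    (hm : 0 < ∫ ω, (S 0 ω - utilization P U S * U 0 ω) ^ 2 ∂P) {h : ℝ → ℝ} {M : ℝ}
    (hh : LipschitzWith 1 h) (hM : ∀ x, |h x| ≤ M) :
    |(∫ ω, h (X ω) ∂P') - ∫ y, h y ∂(expMeasure (approximationRate P U S (utilization P U S)))|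
      ≤ errorBound P U S (utilization P U S) := by
  have hr := approximationRate_pos hU0 hm
  have hF := isTestFunction_steinSolution hr (sub_nonneg.2 hρ.le) hh hM
  have hES := utilization_mul_integral (S := S) hU0.ne'
  have hρ0 : 0 ≤ utilization P U S := nonneg_of_mul_nonneg_left
    (hES.ge.trans' (integral_nonneg_of_ae (hUS.nonneg_service 0))) hU0
  have hU1 := hU.integrable (by norm_num)
  have hS1 := hS.integrable (by norm_num)
  have hmean : ∫ ω, (S 0 ω - utilization P U S * U 0 ω) ∂P = 0 := by
    rw [integral_sub hS1 (hU1.const_mul _), integral_const_mul, hES, sub_self]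
  have hmean_sq := integral_centred_sq (hU.mono_exponent (by norm_num))
    (hS.mono_exponent (by norm_num)) hU0.ne' (utilization P U S)
  have hbound := hUS.integral_interarrival_mul_abs_limit_generator_le hU hS
    (integral_service_lt hU0 hρ) hU0 hF hρ0 hρ.le (inv_nonneg.2 hr.le) hmean hmean_sq
    (hX.tendsto_generator hr.ne' hh.continuous hM hF)
  rw [integral_interarrival_sub_service hU0.ne',
    hUS.integral_cycleBound_steinSolution hU hS hU0 hρ hm, abs_mul,
    abs_of_pos (sub_pos.2 hρ)] at hbound
  exact le_of_mul_le_mul_left (le_of_mul_le_mul_left hbound hU0) (sub_pos.2 hρ)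

end BoundedTestFunctions

section Truncation

/-- The truncation of `x` to the interval `[-a, a]`, for `0 ≤ a`. -/
def clamp (a x : ℝ) : ℝ := max (min x a) (-a)

lemma lipschitzWith_clamp (a : ℝ) : LipschitzWith 1 (clamp a) :=
  (LipschitzWith.id.min_const a).max_const (-a)

lemma abs_clamp_le {a : ℝ} (ha : 0 ≤ a) (x : ℝ) : |clamp a x| ≤ a :=
  abs_le.2 ⟨le_max_right _ _, max_le (min_le_right _ _) ((neg_nonpos.2 ha).trans ha)⟩

lemma abs_clamp_le_abs {a : ℝ} (ha : 0 ≤ a) (x : ℝ) : |clamp a x| ≤ |x| :=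
  abs_le.2 ⟨le_max_of_le_left (le_min (neg_abs_le x) (by linarith [abs_nonneg x])),
    max_le ((min_le_left _ _).trans (le_abs_self x)) (by linarith [abs_nonneg x])⟩

lemma tendsto_clamp (x : ℝ) : Tendsto (fun n : ℕ => clamp n x) atTop (𝓝 x) := by
  refine tendsto_const_nhds.congr' ?_
  filter_upwards [tendsto_natCast_atTop_atTop.eventually_ge_atTop |x|] with n hn
  rw [clamp, min_eq_left (abs_le.1 hn).2, max_eq_left (abs_le.1 hn).1]

lemma tendsto_integral_clamp {α : Type*} [MeasurableSpace α] {μ : Measure α} {f : α → ℝ}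
    (hf : Integrable f μ) :
    Tendsto (fun n : ℕ => ∫ x, clamp n (f x) ∂μ) atTop (𝓝 (∫ x, f x ∂μ)) :=
  tendsto_integral_of_dominated_convergence (fun x => |f x|)
    (fun n => (lipschitzWith_clamp n).continuous.comp_aestronglyMeasurable hf.1) hf.abs
    (fun n => ae_of_all _ fun x => abs_clamp_le_abs n.cast_nonneg (f x))
    (ae_of_all _ fun x => tendsto_clamp (f x))

lemma integrable_of_integral_abs_clamp_le {α : Type*} [MeasurableSpace α] {μ : Measure α}
    [IsFiniteMeasure μ] {f : α → ℝ} (hf : AEMeasurable f μ) {B : ℝ}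
    (hB : ∀ n : ℕ, ∫ x, |clamp n (f x)| ∂μ ≤ B) : Integrable f μ := by
  have hclamp : ∀ n : ℕ, AEStronglyMeasurable (fun x => clamp n (f x)) μ := fun n =>
    (lipschitzWith_clamp n).continuous.comp_aestronglyMeasurable hf.aestronglyMeasurable
  have hint : ∀ n : ℕ, Integrable (fun x => clamp n (f x)) μ := fun n =>
    .of_bound (hclamp n) n (ae_of_all _ fun x => abs_clamp_le n.cast_nonneg (f x))
  have hnorm : ∀ n : ℕ, eLpNorm (fun x => clamp n (f x)) 1 μ ≤ ENNReal.ofReal B := fun n => by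
    rw [eLpNorm_one_eq_lintegral_enorm, ← ofReal_integral_norm_eq_lintegral_enorm (hint n)]
    exact ENNReal.ofReal_le_ofReal (hB n)
  exact memLp_one_iff_integrable.1 ⟨hf.aestronglyMeasurable,
    (Lp.eLpNorm_le_of_ae_tendsto (.of_forall hnorm) hclamp
      (ae_of_all _ fun x => tendsto_clamp (f x))).trans_lt ENNReal.ofReal_lt_top⟩

lemma integrable_lipschitzWith_comp {α : Type*} [MeasurableSpace α] {μ : Measure α}
    [IsFiniteMeasure μ] {K : NNReal} {h : ℝ → ℝ} (hh : LipschitzWith K h) {f : α → ℝ}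
    (hf : Integrable f μ) : Integrable (fun x => h (f x)) μ := by
  have hshift : LipschitzWith K fun x => h x - h 0 := .of_dist_le_mul fun x y => by
    simpa only [dist_sub_right] using hh.dist_le_mul x y
  have hcomp := memLp_one_iff_integrable.1
    (hshift.comp_memLp (sub_self _) (memLp_one_iff_integrable.2 hf))
  exact (hcomp.add (integrable_const (h 0))).congr
    (ae_of_all _ fun x => sub_add_cancel (h (f x)) (h 0))

variable {Ω' : Type*} [MeasurableSpace Ω'] {P' : Measure Ω'} [IsFiniteMeasure P'] {X : Ω' → ℝ}
  {ν : Measure ℝ} [IsFiniteMeasure ν] {b : ℝ}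

lemma integrable_of_bounded_lipschitzWith_le (hX : AEMeasurable X P') (hν : Integrable id ν)
    (hb : ∀ (h : ℝ → ℝ) (M : ℝ), LipschitzWith 1 h → (∀ x, |h x| ≤ M) →
      |(∫ ω, h (X ω) ∂P') - ∫ y, h y ∂ν| ≤ b) : Integrable X P' := by
  have hlip : ∀ n : ℕ, LipschitzWith 1 fun x => |clamp n x| := fun n => by
    simpa [Function.comp_def] using (lipschitzWith_one_norm (E := ℝ)).comp (lipschitzWith_clamp n)
  have hν_le : ∀ n : ℕ, ∫ y, |clamp n y| ∂ν ≤ ∫ y, |y| ∂ν := fun n =>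
    integral_mono (integrable_lipschitzWith_comp (hlip n) hν) hν.abs
      fun y => abs_clamp_le_abs n.cast_nonneg y
  refine integrable_of_integral_abs_clamp_le hX (B := ∫ y, |y| ∂ν + b) fun n => ?_
  have hle := (abs_le.1 (hb _ n (hlip n) fun x => by
    rw [abs_abs]
    exact abs_clamp_le n.cast_nonneg x)).2
  linarith [hν_le n]

lemma abs_integral_sub_le_of_bounded_lipschitzWith_le (hX : AEMeasurable X P')
    (hν : Integrable id ν)
    (hb : ∀ (h : ℝ → ℝ) (M : ℝ), LipschitzWith 1 h → (∀ x, |h x| ≤ M) →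
      |(∫ ω, h (X ω) ∂P') - ∫ y, h y ∂ν| ≤ b) {h : ℝ → ℝ} (hh : LipschitzWith 1 h) :
    |(∫ ω, h (X ω) ∂P') - ∫ y, h y ∂ν| ≤ b := by
  have hXi := integrable_of_bounded_lipschitzWith_le hX hν hb
  have hlim := ((tendsto_integral_clamp (integrable_lipschitzWith_comp hh hXi)).sub
    (tendsto_integral_clamp (integrable_lipschitzWith_comp hh hν))).abs
  refine le_of_tendsto' hlim fun n => hb (fun x => clamp n (h x)) n ?_ fun x =>
    abs_clamp_le n.cast_nonneg (h x)
  simpa [Function.comp_def] using (lipschitzWith_clamp n).comp hh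

end Truncation

end GG1

end

theorem theorem1_general {Ω : Type*} [MeasurableSpace Ω] (P : Measure Ω) [IsProbabilityMeasure P]
    (U S : ℕ → Ω → ℝ) (hUS : GG1.IsInput P U S)
    (hU3 : MemLp (U 0) 3 P) (hS3 : MemLp (S 0) 3 P) (hU0 : 0 < ∫ ω, U 0 ω ∂P)
    (ρ : ℝ) (hρ_def : ρ = GG1.utilization P U S) (hρ : ρ < 1)
    (hm : 0 < ∫ ω, (S 0 ω - ρ * U 0 ω) ^ 2 ∂P)
    {Ω' : Type*} [MeasurableSpace Ω'] (P' : Measure Ω') [IsProbabilityMeasure P']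
    (X : Ω' → ℝ) (hX : GG1.IsTimeAverageLimit P U S P' X) :
    Integrable X P' ∧
    Integrable (fun ω => GG1.idlePeriod U S ω ^ 2) P ∧
    0 < ∫ ω, GG1.idlePeriod U S ω ∂P ∧
    ∀ h : ℝ → ℝ, LipschitzWith 1 h →
      |(∫ ω, h (X ω) ∂P')
        - ∫ y, h y ∂(expMeasure (2 / (GG1.arrivalRate P U * ∫ ω, (S 0 ω - ρ * U 0 ω) ^ 2 ∂P)))|
      ≤ (1 - ρ) *
        ((2 + ρ) * ((∫ ω, U 0 ω ^ 2 ∂P) / (2 * ∫ ω, U 0 ω ∂P))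
          + ρ * ((∫ ω, GG1.idlePeriod U S ω ^ 2 ∂P) / (2 * ∫ ω, GG1.idlePeriod U S ω ∂P))
          + 2 * (∫ ω, S 0 ω ∂P)
          + 4 * ((∫ ω, |S 0 ω - ρ * U 0 ω| ^ 3 ∂P) / ∫ ω, (S 0 ω - ρ * U 0 ω) ^ 2 ∂P)) := by
  subst hρ_def
  have hU2 : MemLp (U 0) 2 P := hU3.mono_exponent (by norm_num)
  have hS2 : MemLp (S 0) 2 P := hS3.mono_exponent (by norm_num)
  have hdrift := GG1.integral_service_lt hU0 hρ
  have hr := GG1.approximationRate_pos hU0 hm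
  have := isProbabilityMeasure_expMeasure hr
  have hY := GG1.integrable_id_expMeasure hr
  have hbounded := fun (h : ℝ → ℝ) (M : ℝ) (hh : LipschitzWith 1 h) (hM : ∀ x, |h x| ≤ M) =>
    hX.abs_integral_sub_le_of_bounded hUS hU3 hS3 hU0 hρ hm hh hM
  exact ⟨GG1.integrable_of_bounded_lipschitzWith_le hX.aemeasurable hY hbounded,
    hUS.integrable_idlePeriod_pow hU2 (hS2.integrable one_le_two) hdrift hU2.integrable_sq,
    hUS.integral_idlePeriod_pos hU2 (hS2.integrable one_le_two) hdrift,
    fun h hh => GG1.abs_integral_sub_le_of_bounded_lipschitzWith_le hX.aemeasurable hY hbounded hh⟩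

theorem theorem1 {Ω : Type*} [MeasurableSpace Ω] (P : Measure Ω) [IsProbabilityMeasure P]
    (U S : ℕ → Ω → ℝ) (hUS : GG1.IsInput P U S)
    (hU3 : MemLp (U 0) 3 P) (hS3 : MemLp (S 0) 3 P)
    (hnl : GG1.Nonlattice P (U 0)) (hS : 0 < ∫ ω, S 0 ω ∂P)
    (ρ : ℝ) (hρ_def : ρ = GG1.utilization P U S) (hρ : ρ < 1)
    {Ω' : Type*} [MeasurableSpace Ω'] (P' : Measure Ω') [IsProbabilityMeasure P']
    (X : Ω' → ℝ) (hX : GG1.IsSteadyState P U S P' X) :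
    Integrable X P' ∧
    Integrable (fun ω => GG1.idlePeriod U S ω ^ 2) P ∧
    0 < ∫ ω, GG1.idlePeriod U S ω ∂P ∧
    ∀ h : ℝ → ℝ, LipschitzWith 1 h →
      |(∫ ω, h (X ω) ∂P')
        - ∫ y, h y ∂(expMeasure (2 / (GG1.arrivalRate P U * ∫ ω, (S 0 ω - ρ * U 0 ω) ^ 2 ∂P)))|
      ≤ (1 - ρ) *
        ((2 + ρ) * ((∫ ω, U 0 ω ^ 2 ∂P) / (2 * ∫ ω, U 0 ω ∂P))
          + ρ * ((∫ ω, GG1.idlePeriod U S ω ^ 2 ∂P) / (2 * ∫ ω, GG1.idlePeriod U S ω ∂P))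
          + 2 * (∫ ω, S 0 ω ∂P)
          + 4 * ((∫ ω, |S 0 ω - ρ * U 0 ω| ^ 3 ∂P) / ∫ ω, (S 0 ω - ρ * U 0 ω) ^ 2 ∂P)) := by
  subst hρ_def
  exact theorem1_general P U S hUS hU3 hS3 (hUS.integral_interarrival_pos (hU3.integrable
    (by norm_num)) hnl) _ rfl hρ (hUS.integral_sq_sub_pos (hU3.mono_exponent (by norm_num))
    (hS3.mono_exponent (by norm_num)) hnl hS.ne' _) P' X (hX.isTimeAverageLimit hUS)
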